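/- Let $(U,V)$ be a bivariate normal random vector with mean zero, variances $\sigma_U^2,\sigma_V^2>0$ and correlation coefficient $\rho\in(-1,1)$, and put $s=\sigma_U\sigma_V$. Let $n\ge 1$, let $Z_1,\dots,Z_n$ be independent copies of $UV$, and let $\overline Z_n=n^{-1}(Z_1+\cdots+Z_n)$. Notation. For $x>0$ and $\nu\in\mathbb R$ let $K_\nu(x)=\int_0^\infty e^{-x\cosh t}\cosh(\nu t)\,dt$ be the modified Bessel function of the second kind, let $$\tilde t_{\mu,\nu}(x)=\sum_{k=0}^\infty\frac{(x/2)^{\mu+2k+1}}{\Gamma\left(k+\frac{\mu-\nu+3}{2}\right)\Gamma\left(k+\frac{\mu+\nu+3}{2}\right)}$$ be the normalised modified Lommel function of the first kind, and for $\mu\ge\nu>-1/2$ let $$G_{\mu,\nu}(x)=x\big(K_\nu(x)\tilde t_{\mu-1,\nu-1}(x)+K_{\nu-1}(x)\tilde t_{\mu,\nu}(x)\big),\qquad \tilde G_{\mu,\nu}(x)=1-G_{\mu,\nu}(x),$$ with $G_{\mu,\nu}(0)=0$, $\tilde G_{\mu,\nu}(0)=1$ (the limits as $x\downarrow0$). Let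 ${}_2F_1$ be the Gaussian hypergeometric function, and let $\mathrm{sgn}$ be the sign function with $\mathrm{sgn}(0)=0$. For $\nu>-1/2$, $0\le|\beta|<\alpha$ and $\mu\in\mathbb R$, $\mathrm{VG}(\nu,\alpha,\beta,\mu)$ denotes the variance-gamma distribution on $\mathbb R$ with density $$p(x)=\frac{(\alpha^2-\beta^2)^{\nu+1/2}}{\sqrt\pi(2\alpha)^\nu\Gamma(\nu+1/2)}\,e^{\beta(x-\mu)}|x-\mu|^\nu K_\nu(\alpha|x-\mu|).$$ Then $$\overline Z_n\sim\mathrm{VG}\Big(\frac{n-1}{2},\frac{n}{s(1-\rho^2)},\frac{n\rho}{s(1-\rho^2)},0\Big),$$ and the distribution function $F(x)=\mathbb P(\overline Z_n\le x)$ is given by the following formulas, in which all series converge. For $x\ge0$, $$F(x)=1-\frac{(1-\rho^2)^{n/2}}{2\sqrt\pi\,\Gamma(n/2)}\sum_{k=0}^\infty\frac{(2\rho)^k}{k!}\Gamma\Big(\frac{k+1}{2}\Big)\Gamma\Big(\frac{n+k}{2}\Big)\tilde G_{\frac{n-1}{2}+k,\frac{n-1}{2}}\Big(\frac{nx}{s(1-\rho^2)}\Big);$$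 for $x<0$, $$F(x)=\frac{(1-\rho^2)^{n/2}}{2\sqrt\pi\,\Gamma(n/2)}\sum_{k=0}^\infty\frac{(-2\rho)^k}{k!}\Gamma\Big(\frac{k+1}{2}\Big)\Gamma\Big(\frac{n+k}{2}\Big)\tilde G_{\frac{n-1}{2}+k,\frac{n-1}{2}}\Big(-\frac{nx}{s(1-\rho^2)}\Big);$$ and, for all $x\in\mathbb R$, $$F(x)=\frac12-\frac{\Gamma((n+1)/2)}{\sqrt\pi\,\Gamma(n/2)}\rho(1-\rho^2)^{n/2}{}_2F_1\Big(1,\frac{n+1}{2};\frac32;\rho^2\Big)+\frac{(1-\rho^2)^{n/2}}{2\sqrt\pi\,\Gamma(n/2)}\sum_{k=0}^\infty(\mathrm{sgn}(x))^{k+1}\frac{(2\rho)^k}{k!}\Gamma\Big(\frac{k+1}{2}\Big)\Gamma\Big(\frac{n+k}{2}\Big)G_{\frac{n-1}{2}+k,\frac{n-1}{2}}\Big(\frac{n|x|}{s(1-\rho^2)}\Big).$$ In particular, $$\mathbb P(\overline Z_n\le0)=\frac12-\frac{\Gamma((n+1)/2)}{\sqrt\pi\,\Gamma(n/2)}\rho(1-\rho^2)^{n/2}{}_2F_1\Big(1,\frac{n+1}{2};\frac32;\rho^2\Big).$$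 -/

import Mathlib

open MeasureTheory ProbabilityTheory

noncomputable section

/-- The modified Bessel function of the second kind
`K_ν(x) = ∫_0^∞ exp(-x cosh t) cosh(ν t) dt`, for `x > 0`. -/
def besselK (ν x : ℝ) : ℝ :=
  ∫ t in Set.Ioi (0 : ℝ), Real.exp (-x * Real.cosh t) * Real.cosh (ν * t)

/-- The normalised modified Lommel function of the first kind, `t̃_{μ,ν}(x)`, as a series. -/
def lommelT (μ ν x : ℝ) : ℝ :=
  ∑' k : ℕ, (x / 2) ^ (μ + 2 * (k : ℝ) + 1) /
    (Real.Gamma ((k : ℝ) + (μ - ν + 3) / 2) * Real.Gamma ((k : ℝ) + (μ + ν + 3) / 2))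

/-- `G_{μ,ν}(x) = x (K_ν(x) t̃_{μ-1,ν-1}(x) + K_{ν-1}(x) t̃_{μ,ν}(x))`. For `μ ≥ ν > -1/2` the
right-hand side tends to `0` as `x ↓ 0`; here `lommelG μ ν 0 = 0` because of the factor `x`. -/
def lommelG (μ ν x : ℝ) : ℝ :=
  x * (besselK ν x * lommelT (μ - 1) (ν - 1) x + besselK (ν - 1) x * lommelT μ ν x)

/-- `G̃_{μ,ν}(x) = 1 - G_{μ,ν}(x)`. -/
def lommelGTilde (μ ν x : ℝ) : ℝ := 1 - lommelG μ ν x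

/-- The variance-gamma density with parameters `ν > -1/2`, `0 ≤ |β| < α`, `μ ∈ ℝ`. -/
def vgPDF (ν α β μ x : ℝ) : ℝ :=
  (α ^ 2 - β ^ 2) ^ (ν + 1 / 2) / (Real.sqrt Real.pi * (2 * α) ^ ν * Real.Gamma (ν + 1 / 2)) *
    Real.exp (β * (x - μ)) * |x - μ| ^ ν * besselK ν (α * |x - μ|)

/-- The variance-gamma distribution `VG(ν, α, β, μ)`. -/
def vgMeasure (ν α β μ : ℝ) : Measure ℝ :=
  volume.withDensity fun x => ENNReal.ofReal (vgPDF ν α β μ x)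

end

/-!
The law of the mean is identified through its moment generating function. For centred jointly
normal `(U, V)` write `V = c U + W` with `W` normal and independent of `U`; integrating out `W` and
then `U` gives `E exp (t U V) = (1 - 2 ρ s t - s² (1 - ρ²) t²) ^ (-1/2)` for small `t`
(`lintegral_exp_mul_normal_product`). On the other side, multiplying the variance-gamma density by
`exp (t x)` merely replaces `β` by `β + t`, so the whole moment generating function follows from
the fact that every variance-gamma density has total mass one (`lintegral_vgPDF`,
`lintegral_exp_vgMeasure`). The two functions agree near `0`, and this determines the law because
the complex moment generating functions are analytic on a strip around the imaginary axis
(`ext_of_mgf_eqOn`).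

The substitution `s = (x / 2) e ^ t` in the integral defining `K_ν(x)` yields an integral which is
Gaussian in `x` and of Gamma type in `s` (`ofReal_besselK_eq_lintegral_rpow`). By Tonelli's theorem
it gives both the total mass of the variance-gamma density and the Mellin transform
`∫₀^∞ x ^ μ K_ν(x) dx = 2 ^ (μ - 1) Γ((μ - ν + 1) / 2) Γ((μ + ν + 1) / 2)`. The recurrences for the
derivatives of `K_ν` and of the Lommel series show that `G_{μ,ν}` is the primitive of
`x ^ μ K_ν(x)` vanishing at `0`, divided by this same constant (`hasDerivAt_lommelG`,
`tendsto_lommelG_zero`). Hence `G` and `1 - G` describe the integral of `x ^ μ K_ν(x)` over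
`(0, x]` and over `(x, ∞)`.

For the distribution function, `exp (β y)` is expanded in the density, and the series is integrated
term by term over a subset of the positive half-line, dominated by the density with `|β|` in place
of `β` (`hasSum_setIntegral_vgPDF`). The negative half-line is reduced to the positive one by
reflection, which changes the sign of `ρ`. At the origin the masses of the two half-lines are
the tail series for `ρ` and for `-ρ`; they sum to one, and their difference retains only the odd
terms, which form the hypergeometric series (`integral_Iic_zero_vgPDF`).
-/

/-! ### The modified Bessel function of the second kind -/

open Set Filter Topology in
/-- The double exponential decay of `exp (-x * cosh t)` absorbs any exponential growth. -/
lemma integrableOn_exp_neg_mul_cosh_mul {x c : ℝ} (hx : 0 < x) {g : ℝ → ℝ} (hg : Continuous g)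
    (hgc : ∀ t, 0 ≤ t → |g t| ≤ Real.exp (c * t)) :
    IntegrableOn (fun t => Real.exp (-x * Real.cosh t) * g t) (Ioi 0) := by
  refine integrable_of_isBigO_exp_neg one_pos (by fun_prop) ?_
  -- `exp (-x * cosh t)` is `O (exp (-n * t))` for every `n`; this choice leaves a spare `exp (-t)`
  obtain ⟨n, hn⟩ := exists_nat_ge (c + 1)
  refine Asymptotics.IsBigO.of_bound ((n.factorial : ℝ) * (2 / x) ^ n) ?_
  filter_upwards [eventually_ge_atTop 0] with t ht
  have hc : Real.exp t / 2 ≤ Real.cosh t := by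
    rw [Real.cosh_eq]; linarith [Real.exp_pos (-t)]
  have h1 : (x * (Real.exp t / 2)) ^ n / n.factorial ≤ Real.exp (x * Real.cosh t) :=
    (Real.pow_div_factorial_le_exp _ (by positivity) n).trans
      (Real.exp_le_exp.2 (mul_le_mul_of_nonneg_left hc hx.le))
  have h2 : Real.exp (-x * Real.cosh t) ≤ n.factorial * (2 / x) ^ n * Real.exp (-(n * t)) := by
    rw [neg_mul, Real.exp_neg, Real.exp_neg, Real.exp_nat_mul]
    rw [inv_le_comm₀ (by positivity) (by positivity)]
    refine le_trans (le_of_eq ?_) h1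
    rw [mul_inv, inv_inv, mul_inv, ← inv_pow, inv_div, mul_assoc, ← mul_pow, mul_comm,
      div_eq_mul_inv]
    congr 2
    ring
  rw [Real.norm_eq_abs, abs_mul, abs_of_pos (Real.exp_pos _), Real.norm_eq_abs,
    abs_of_pos (Real.exp_pos _)]
  calc Real.exp (-x * Real.cosh t) * |g t|
      ≤ (n.factorial * (2 / x) ^ n * Real.exp (-(n * t))) * Real.exp (c * t) := by
        gcongr; exact hgc t ht
    _ = n.factorial * (2 / x) ^ n * Real.exp (-(n * t) + c * t) := by rw [Real.exp_add]; ring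
    _ ≤ _ := by
        gcongr
        nlinarith

lemma cosh_mul_le_exp (ν : ℝ) {t : ℝ} (ht : 0 ≤ t) : Real.cosh (ν * t) ≤ Real.exp (|ν| * t) := by
  rw [← Real.cosh_abs, abs_mul, abs_of_nonneg ht, Real.cosh_eq]
  have : Real.exp (-(|ν| * t)) ≤ Real.exp (|ν| * t) := by
    apply Real.exp_le_exp.2
    have : 0 ≤ |ν| * t := by positivity
    linarith
  linarith

lemma abs_sinh_mul_le_exp (ν : ℝ) {t : ℝ} (ht : 0 ≤ t) :
    |Real.sinh (ν * t)| ≤ Real.exp (|ν| * t) := by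
  refine le_trans ?_ (cosh_mul_le_exp ν ht)
  rw [abs_le]
  have h1 := Real.cosh_sub_sinh (ν * t)
  have h2 := Real.cosh_add_sinh (ν * t)
  constructor <;> linarith [Real.exp_pos (ν * t), Real.exp_pos (-(ν * t))]

lemma integrableOn_besselK (ν : ℝ) {x : ℝ} (hx : 0 < x) :
    IntegrableOn (fun t => Real.exp (-x * Real.cosh t) * Real.cosh (ν * t)) (Set.Ioi 0) :=
  integrableOn_exp_neg_mul_cosh_mul (c := |ν|) hx (by fun_prop) fun t ht => by
    rw [abs_of_pos (Real.cosh_pos _)]; exact cosh_mul_le_exp ν ht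

lemma integrableOn_cosh_mul_besselK (ν : ℝ) {x : ℝ} (hx : 0 < x) :
    IntegrableOn (fun t => Real.exp (-x * Real.cosh t) * (Real.cosh t * Real.cosh (ν * t)))
      (Set.Ioi 0) :=
  integrableOn_exp_neg_mul_cosh_mul (c := 1 + |ν|) hx (by fun_prop) fun t ht => by
    rw [abs_of_pos (mul_pos (Real.cosh_pos _) (Real.cosh_pos _)), add_mul, Real.exp_add]
    have h := cosh_mul_le_exp 1 ht
    rw [abs_one, one_mul] at h
    gcongr
    · simpa using h
    · exact cosh_mul_le_exp ν ht

lemma integrableOn_sinh_mul_sinh (ν : ℝ) {x : ℝ} (hx : 0 < x) :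
    IntegrableOn (fun t => Real.exp (-x * Real.cosh t) * (Real.sinh t * Real.sinh (ν * t)))
      (Set.Ioi 0) :=
  integrableOn_exp_neg_mul_cosh_mul (c := 1 + |ν|) hx (by fun_prop) fun t ht => by
    rw [abs_mul, add_mul, Real.exp_add]
    have h := abs_sinh_mul_le_exp 1 ht
    rw [abs_one, one_mul] at h
    gcongr
    · simpa using h
    · exact abs_sinh_mul_le_exp ν ht

lemma besselK_neg (ν x : ℝ) : besselK (-ν) x = besselK ν x := by
  simp only [besselK, neg_mul, Real.cosh_neg]

lemma besselK_nonneg (ν x : ℝ) : 0 ≤ besselK ν x :=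
  integral_nonneg fun _ => mul_nonneg (Real.exp_nonneg _) (Real.cosh_pos _).le

lemma measurable_besselK (ν : ℝ) : Measurable (besselK ν) := by
  have : StronglyMeasurable (Function.uncurry fun x t : ℝ =>
      Real.exp (-x * Real.cosh t) * Real.cosh (ν * t)) := by
    apply Continuous.stronglyMeasurable
    unfold Function.uncurry
    fun_prop
  exact (this.integral_prod_right (ν := volume.restrict (Set.Ioi 0))).measurable

lemma besselK_mono {ν a x : ℝ} (hx : 0 < x) (h : |ν| ≤ a) : besselK ν x ≤ besselK a x := by
  refine setIntegral_mono_on (integrableOn_besselK ν hx) (integrableOn_besselK a hx)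
    measurableSet_Ioi fun t _ => ?_
  gcongr 1
  rw [Real.cosh_le_cosh, abs_mul, abs_mul]
  exact mul_le_mul_of_nonneg_right (h.trans (le_abs_self a)) (abs_nonneg _)

open Set Filter Topology in
/-- Differentiation under the integral sign. -/
lemma hasDerivAt_besselK_integral (ν : ℝ) {x : ℝ} (hx : 0 < x) :
    HasDerivAt (besselK ν)
      (-∫ t in Ioi (0 : ℝ), Real.exp (-x * Real.cosh t) * (Real.cosh t * Real.cosh (ν * t))) x := by
  have hx2 : 0 < x / 2 := by positivity
  have := (hasDerivAt_integral_of_dominated_loc_of_deriv_le (μ := volume.restrict (Ioi (0 : ℝ)))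
    (F := fun y t => Real.exp (-y * Real.cosh t) * Real.cosh (ν * t))
    (F' := fun y t => -(Real.exp (-y * Real.cosh t) * (Real.cosh t * Real.cosh (ν * t))))
    (x₀ := x) (s := Ioi (x / 2))
    (bound := fun t => Real.exp (-(x / 2) * Real.cosh t) * (Real.cosh t * Real.cosh (ν * t)))
    (Ioi_mem_nhds (by linarith)) (Eventually.of_forall fun y => by
      exact Continuous.aestronglyMeasurable (by fun_prop))
    (integrableOn_besselK ν hx)
    (Continuous.aestronglyMeasurable (by fun_prop))
    (ae_of_all _ fun t y hy => by
      have h1 := Real.cosh_pos t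
      have h2 := Real.cosh_pos (ν * t)
      rw [norm_neg, Real.norm_eq_abs, abs_of_pos (by positivity)]
      gcongr
      exact le_of_lt hy)
    (integrableOn_cosh_mul_besselK ν hx2)
    (ae_of_all _ fun t y hy => by
      have h := (((hasDerivAt_id y).neg.mul_const (Real.cosh t)).exp).mul_const (Real.cosh (ν * t))
      refine HasDerivAt.congr_deriv h ?_
      simp only [Pi.neg_apply, id_eq]
      ring)).2
  rwa [integral_neg] at this

open Set Filter Topology in
/-- Integration by parts in the integral defining `K_ν`. -/
lemma integral_sinh_mul_sinh (ν : ℝ) {x : ℝ} (hx : 0 < x) :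
    x * ∫ t in Ioi (0 : ℝ), Real.exp (-x * Real.cosh t) * (Real.sinh t * Real.sinh (ν * t)) =
      ν * besselK ν x := by
  have hI := ((integrableOn_besselK ν hx).const_mul ν).sub
    ((integrableOn_sinh_mul_sinh ν hx).const_mul x)
  have hder (t : ℝ) : HasDerivAt (fun t => Real.exp (-x * Real.cosh t) * Real.sinh (ν * t))
      (ν * (Real.exp (-x * Real.cosh t) * Real.cosh (ν * t)) -
        x * (Real.exp (-x * Real.cosh t) * (Real.sinh t * Real.sinh (ν * t)))) t := by
    have h1 := ((Real.hasDerivAt_cosh t).const_mul (-x)).exp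
    have h2 := (((hasDerivAt_id t).const_mul ν)).sinh
    refine HasDerivAt.congr_deriv (h1.mul h2) ?_
    simp only [id_eq]
    ring
  have key := integral_Ioi_of_hasDerivAt_of_tendsto
    (f := fun t => Real.exp (-x * Real.cosh t) * Real.sinh (ν * t)) (a := 0) (m := 0)
    (f' := fun t => ν * (Real.exp (-x * Real.cosh t) * Real.cosh (ν * t)) -
      x * (Real.exp (-x * Real.cosh t) * (Real.sinh t * Real.sinh (ν * t))))
    (Continuous.continuousWithinAt (by fun_prop))
    (fun t _ => hder t)
    hI
    (tendsto_zero_of_hasDerivAt_of_integrableOn_Ioi (a := 0) (fun t _ => hder t) hI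
      (integrableOn_exp_neg_mul_cosh_mul hx (by fun_prop) fun t ht => abs_sinh_mul_le_exp ν ht))
  rw [integral_sub ((integrableOn_besselK ν hx).const_mul ν)
    ((integrableOn_sinh_mul_sinh ν hx).const_mul x), integral_const_mul, integral_const_mul] at key
  simp only [mul_zero, Real.sinh_zero, sub_zero] at key
  rw [besselK]
  linarith

open Set in
/-- `K_ν' = -K_{ν-1} - (ν / x) K_ν`. -/
lemma hasDerivAt_besselK (ν : ℝ) {x : ℝ} (hx : 0 < x) :
    HasDerivAt (besselK ν) (-besselK (ν - 1) x - ν / x * besselK ν x) x := by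
  convert hasDerivAt_besselK_integral ν hx using 1
  have h := integral_sinh_mul_sinh ν hx
  have h1 : besselK (ν - 1) x +
      ∫ t in Ioi (0 : ℝ), Real.exp (-x * Real.cosh t) * (Real.sinh t * Real.sinh (ν * t)) =
      ∫ t in Ioi (0 : ℝ), Real.exp (-x * Real.cosh t) * (Real.cosh t * Real.cosh (ν * t)) := by
    rw [besselK, ← integral_add (integrableOn_besselK _ hx) (integrableOn_sinh_mul_sinh ν hx)]
    congr 1 with t
    rw [sub_mul, one_mul, Real.cosh_sub]
    ring
  rw [← h1, div_mul_eq_mul_div, ← h]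
  field_simp
  ring

open Set in
/-- `K_{ν-1}' = -K_ν + ((ν - 1) / x) K_{ν-1}`, by evenness of `K` in the order. -/
lemma hasDerivAt_besselK_sub_one (ν : ℝ) {x : ℝ} (hx : 0 < x) :
    HasDerivAt (besselK (ν - 1)) (-besselK ν x + (ν - 1) / x * besselK (ν - 1) x) x := by
  have h := hasDerivAt_besselK (1 - ν) hx
  rw [← besselK_neg ν x, ← besselK_neg (ν - 1) x]
  convert h using 1
  · ext y
    rw [← besselK_neg]; ring_nf
  · rw [show 1 - ν - 1 = -ν by ring, show -(ν - 1) = 1 - ν by ring]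
    ring

open Set in
/-- `K_ν` as half an integral over the whole line. -/
lemma ofReal_besselK (ν : ℝ) {x : ℝ} (hx : 0 < x) :
    ENNReal.ofReal (besselK ν x) = ENNReal.ofReal (1 / 2) *
      ∫⁻ t : ℝ, ENNReal.ofReal (Real.exp (-x * Real.cosh t) * Real.exp (-ν * t)) := by
  have hneg : ∫⁻ t in Iic (0 : ℝ),
      ENNReal.ofReal (Real.exp (-x * Real.cosh t) * Real.exp (-ν * t)) =
      ∫⁻ t in Ioi (0 : ℝ), ENNReal.ofReal (Real.exp (-x * Real.cosh t) * Real.exp (ν * t)) := by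
    have h := (Measure.measurePreserving_neg (volume : Measure ℝ)).setLIntegral_comp_preimage_emb
      (MeasurableEquiv.neg ℝ).measurableEmbedding
      (fun t => ENNReal.ofReal (Real.exp (-x * Real.cosh t) * Real.exp (-ν * t))) (Iio 0)
    rw [setLIntegral_congr Iio_ae_eq_Iic.symm, ← h]
    simp
  rw [← lintegral_add_compl _ (measurableSet_Ioi (a := (0 : ℝ))), compl_Ioi, hneg,
    ← lintegral_add_right _ (by fun_prop), besselK,
    ofReal_integral_eq_lintegral_ofReal (integrableOn_besselK ν hx)
      (ae_of_all _ fun t => mul_nonneg (Real.exp_nonneg _) (Real.cosh_pos _).le),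
    ← lintegral_const_mul _ (by fun_prop)]
  congr 1 with t
  rw [← ENNReal.ofReal_add (by positivity) (by positivity), ← ENNReal.ofReal_mul (by norm_num),
    Real.cosh_eq (ν * t), neg_mul ν]
  congr 1
  ring

open Set in
/-- The substitution `s = (x / 2) e ^ t` turns the hyperbolic integral for `K_ν` into an integral
of Gaussian type in `x`. -/
lemma ofReal_besselK_eq_lintegral_rpow (ν : ℝ) {x : ℝ} (hx : 0 < x) :
    ENNReal.ofReal (besselK ν x) = ENNReal.ofReal (1 / 2 * (x / 2) ^ ν) *
      ∫⁻ s in Ioi (0 : ℝ), ENNReal.ofReal (s ^ (-ν - 1) * Real.exp (-s - x ^ 2 / (4 * s))) := by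
  have himg : (fun t => x / 2 * Real.exp t) '' univ = Ioi (0 : ℝ) := by
    ext s
    simp only [image_univ, mem_range, mem_Ioi]
    constructor
    · rintro ⟨t, rfl⟩; positivity
    · intro hs
      refine ⟨Real.log (s / (x / 2)), ?_⟩
      rw [Real.exp_log (by positivity)]
      field_simp
  have hcv := lintegral_image_eq_lintegral_deriv_mul_of_monotoneOn (s := univ)
    (f := fun t => x / 2 * Real.exp t) (f' := fun t => x / 2 * Real.exp t) MeasurableSet.univ
    (fun t _ => ((Real.hasDerivAt_exp t).const_mul _).hasDerivWithinAt)
    (fun a _ b _ hab => mul_le_mul_of_nonneg_left (Real.exp_le_exp.2 hab) (by positivity))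
    (fun s => ENNReal.ofReal (s ^ (-ν - 1) * Real.exp (-s - x ^ 2 / (4 * s))))
  rw [himg, Measure.restrict_univ] at hcv
  rw [hcv, ofReal_besselK ν hx, ENNReal.ofReal_mul (by norm_num), mul_assoc]
  congr 1
  rw [← lintegral_const_mul _ (by fun_prop)]
  congr 1 with t
  rw [← ENNReal.ofReal_mul (by positivity), ← ENNReal.ofReal_mul (by positivity)]
  congr 1
  have he := Real.exp_pos t
  have h1 : (x / 2 * Real.exp t) ^ (-ν - 1) * (x / 2 * Real.exp t) =
      (x / 2) ^ (-ν) * Real.exp (-ν * t) := by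
    rw [← Real.rpow_add_one (by positivity), sub_add_cancel,
      Real.mul_rpow (by positivity) he.le, ← Real.exp_mul, mul_comm t]
  have h2 : -(x / 2 * Real.exp t) - x ^ 2 / (4 * (x / 2 * Real.exp t)) = -x * Real.cosh t := by
    rw [Real.cosh_eq, Real.exp_neg]
    field_simp
    ring
  have h3 : (x / 2) ^ ν * (x / 2) ^ (-ν) = 1 := by
    rw [← Real.rpow_add (by positivity), add_neg_cancel, Real.rpow_zero]
  rw [h2]
  calc _ = ((x / 2) ^ ν * (x / 2) ^ (-ν)) * (Real.exp (-x * Real.cosh t) * Real.exp (-ν * t)) := by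
        rw [h3, one_mul]
    _ = _ := by linear_combination (-(x / 2) ^ ν * Real.exp (-x * Real.cosh t)) * h1

open Set in
lemma lintegral_rpow_mul_exp_neg_mul {a r : ℝ} (ha : 0 < a) (hr : 0 < r) :
    ∫⁻ s in Ioi (0 : ℝ), ENNReal.ofReal (s ^ (a - 1) * Real.exp (-(r * s))) =
      ENNReal.ofReal ((1 / r) ^ a * Real.Gamma a) := by
  have hpos : 0 < (1 / r) ^ a * Real.Gamma a := by
    have := Real.Gamma_pos_of_pos ha
    positivity
  rw [← Real.integral_rpow_mul_exp_neg_mul_Ioi ha hr] at hpos ⊢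
  rw [ofReal_integral_eq_lintegral_ofReal]
  · by_contra h
    -- an integral with a nonzero value cannot be that of a non-integrable function
    rw [integral_undef h] at hpos
    exact hpos.false
  · filter_upwards [self_mem_ae_restrict measurableSet_Ioi] with s hs
    have : 0 < s := hs
    simp only [Pi.zero_apply]
    positivity

open Set in
lemma lintegral_rpow_mul_exp_neg_mul_sq {q b : ℝ} (hq : -1 < q) (hb : 0 < b) :
    ∫⁻ x in Ioi (0 : ℝ), ENNReal.ofReal (x ^ q * Real.exp (-b * x ^ 2)) =
      ENNReal.ofReal (b ^ (-(q + 1) / 2) * (1 / 2) * Real.Gamma ((q + 1) / 2)) := by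
  rw [← integral_rpow_mul_exp_neg_mul_rpow two_pos hq hb, ofReal_integral_eq_lintegral_ofReal
    (integrableOn_rpow_mul_exp_neg_mul_rpow hq two_pos hb)]
  · simp only [Real.rpow_two]
  · filter_upwards [self_mem_ae_restrict measurableSet_Ioi] with s hs
    have : 0 < s := hs
    simp only [Pi.zero_apply]
    positivity

/-- Monotonicity in the order reduces the behaviour of `K_ν` near zero to `a > 0`, where
`exp (-x ^ 2 / (4 * s)) ≤ 1` leaves a Gamma integral. -/
lemma besselK_le_rpow {ν a x : ℝ} (hx : 0 < x) (ha : 0 < a) (h : |ν| ≤ a) :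
    besselK ν x ≤ Real.Gamma a * 2 ^ a * x ^ (-a) := by
  refine (besselK_mono hx h).trans ?_
  have hG := Real.Gamma_pos_of_pos ha
  rw [← ENNReal.ofReal_le_ofReal_iff (by positivity), ← besselK_neg,
    ofReal_besselK_eq_lintegral_rpow (-a) hx]
  have h1 := lintegral_rpow_mul_exp_neg_mul ha one_pos
  rw [div_one, Real.one_rpow, one_mul] at h1
  calc _ ≤ ENNReal.ofReal (1 / 2 * (x / 2) ^ (-a)) * ENNReal.ofReal (Real.Gamma a) := by
        rw [← h1]
        gcongr _ * ?_
        refine setLIntegral_mono' measurableSet_Ioi fun s hs => ?_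
        have hs : 0 < s := hs
        rw [neg_neg]
        gcongr
        have : 0 ≤ x ^ 2 / (4 * s) := by positivity
        linarith
    _ ≤ _ := by
        rw [← ENNReal.ofReal_mul (by positivity)]
        apply ENNReal.ofReal_le_ofReal
        rw [Real.div_rpow hx.le zero_le_two, Real.rpow_neg zero_le_two, div_inv_eq_mul]
        have : 0 < x ^ (-a) * 2 ^ a * Real.Gamma a := by positivity
        linarith

open Set in
/-- The Mellin transform of `K_ν`. -/
lemma lintegral_rpow_mul_besselK {μ ν : ℝ} (h1 : 0 < μ - ν + 1) (h2 : 0 < μ + ν + 1) :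
    ∫⁻ x in Ioi (0 : ℝ), ENNReal.ofReal (x ^ μ * besselK ν x) =
      ENNReal.ofReal (2 ^ (μ - 1) * Real.Gamma ((μ - ν + 1) / 2) * Real.Gamma ((μ + ν + 1) / 2)) := by
  have hG1 := Real.Gamma_pos_of_pos (half_pos h1)
  have hG2 := Real.Gamma_pos_of_pos (half_pos h2)
  have step1 : ∀ x ∈ Ioi (0 : ℝ), ENNReal.ofReal (x ^ μ * besselK ν x) =
      ∫⁻ s in Ioi (0 : ℝ), ENNReal.ofReal (1 / 2 * (1 / 2) ^ ν * (s ^ (-ν - 1) * Real.exp (-s))) *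
        ENNReal.ofReal (x ^ (μ + ν) * Real.exp (-(1 / (4 * s)) * x ^ 2)) := by
    intro x hx
    have hx : 0 < x := hx
    rw [ENNReal.ofReal_mul (by positivity), ofReal_besselK_eq_lintegral_rpow ν hx, ← mul_assoc,
      ← lintegral_const_mul _ (by fun_prop)]
    refine setLIntegral_congr_fun measurableSet_Ioi fun s hs => ?_
    have hs : 0 < s := hs
    rw [← ENNReal.ofReal_mul (by positivity), ← ENNReal.ofReal_mul (by positivity),
      ← ENNReal.ofReal_mul (by positivity), sub_eq_add_neg (-s), Real.exp_add,
      Real.rpow_add hx, div_eq_mul_inv x, Real.mul_rpow hx.le (by positivity), ← one_div,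
      show -(x ^ 2 / (4 * s)) = -(1 / (4 * s)) * x ^ 2 by ring]
    congr 1
    ring
  have step2 : ∀ s ∈ Ioi (0 : ℝ), (∫⁻ x in Ioi (0 : ℝ),
      ENNReal.ofReal (1 / 2 * (1 / 2) ^ ν * (s ^ (-ν - 1) * Real.exp (-s))) *
        ENNReal.ofReal (x ^ (μ + ν) * Real.exp (-(1 / (4 * s)) * x ^ 2))) =
      ENNReal.ofReal (2 ^ (μ - 1) * Real.Gamma ((μ + ν + 1) / 2)) *
      ENNReal.ofReal (s ^ ((μ - ν + 1) / 2 - 1) * Real.exp (-(1 * s))) := by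
    intro s hs
    have hs : 0 < s := hs
    rw [lintegral_const_mul _ (by fun_prop),
      lintegral_rpow_mul_exp_neg_mul_sq (by linarith) (by positivity),
      ← ENNReal.ofReal_mul (by positivity), ← ENNReal.ofReal_mul (by positivity)]
    congr 1
    have e1 : (1 / (4 * s)) ^ (-(μ + ν + 1) / 2) = 2 ^ (μ + ν + 1) * s ^ ((μ + ν + 1) / 2) := by
      rw [one_div, Real.inv_rpow (by positivity), ← Real.rpow_neg (by positivity),
        Real.mul_rpow (by norm_num) hs.le, show (4 : ℝ) = 2 ^ (2 : ℝ) by norm_num,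
        ← Real.rpow_mul (by norm_num)]
      congr 2 <;> ring
    have e2 : (2 : ℝ) ^ (μ - 1) = 1 / 2 * (1 / 2) ^ ν * 2 ^ (μ + ν + 1) * (1 / 2) := by
      rw [one_div, Real.inv_rpow (by norm_num), ← Real.rpow_neg (by norm_num),
        show μ - 1 = -ν + (μ + ν + 1) - 2 by ring, Real.rpow_sub two_pos, Real.rpow_add two_pos]
      norm_num
      ring
    have e3 : s ^ ((μ - ν + 1) / 2 - 1) = s ^ (-ν - 1) * s ^ ((μ + ν + 1) / 2) := by
      rw [← Real.rpow_add hs]; congr 1; ring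
    rw [e1, e2, e3, one_mul]
    ring
  rw [setLIntegral_congr_fun measurableSet_Ioi step1, lintegral_lintegral_swap,
    setLIntegral_congr_fun measurableSet_Ioi step2, lintegral_const_mul _ (by fun_prop),
    lintegral_rpow_mul_exp_neg_mul (by linarith) one_pos, ← ENNReal.ofReal_mul (by positivity)]
  · congr 1
    rw [div_one, Real.one_rpow]
    ring
  · apply Measurable.aemeasurable
    unfold Function.uncurry
    fun_prop

/-! ### The modified Lommel function and the primitive of `x ^ μ K_ν(x)` -/

/-- The entire function `∑ y ^ k / (Γ (k + A) Γ (k + B))`; up to a power of `x`, the modified Lommel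
function `lommelT` is its value at `(x / 2) ^ 2`. -/
noncomputable def lommelSeries (A B y : ℝ) : ℝ :=
  ∑' k : ℕ, y ^ k / (Real.Gamma (k + A) * Real.Gamma (k + B))

open Filter Topology in
lemma summable_lommelSeries {A B : ℝ} (hA : 0 < A) (hB : 0 < B) (y : ℝ) :
    Summable fun k : ℕ => y ^ k / (Real.Gamma (k + A) * Real.Gamma (k + B)) := by
  rcases eq_or_ne y 0 with rfl | hy
  · refine summable_of_ne_finset_zero (s := {0}) fun k hk => ?_
    rw [zero_pow (by simpa using hk), zero_div]
  have hGA (k : ℕ) : 0 < Real.Gamma (k + A) := Real.Gamma_pos_of_pos (by positivity)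
  have hGB (k : ℕ) : 0 < Real.Gamma (k + B) := Real.Gamma_pos_of_pos (by positivity)
  refine summable_of_ratio_test_tendsto_lt_one (l := 0) one_pos (Eventually.of_forall fun k =>
    div_ne_zero (pow_ne_zero _ hy) (mul_pos (hGA k) (hGB k)).ne') ?_
  have h (k : ℕ) : ‖y ^ (k + 1) / (Real.Gamma ((k + 1 : ℕ) + A) * Real.Gamma ((k + 1 : ℕ) + B))‖ /
      ‖y ^ k / (Real.Gamma (k + A) * Real.Gamma (k + B))‖ = |y| * ((k + A)⁻¹ * (k + B)⁻¹) := by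
    have h1 : 0 < k + A := by positivity
    have h2 : 0 < k + B := by positivity
    have e1 : Real.Gamma ((k + 1 : ℕ) + A) = (k + A) * Real.Gamma (k + A) := by
      rw [← Real.Gamma_add_one h1.ne']; push_cast; congr 1; ring
    have e2 : Real.Gamma ((k + 1 : ℕ) + B) = (k + B) * Real.Gamma (k + B) := by
      rw [← Real.Gamma_add_one h2.ne']; push_cast; congr 1; ring
    have := hGA k
    have := hGB k
    have hy' : 0 < |y| := abs_pos.2 hy
    have h3 := mul_pos (hGA k) (hGB k)
    have h4 := mul_pos (mul_pos h1 (hGA k)) (mul_pos h2 (hGB k))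
    rw [e1, e2, norm_div, norm_div, norm_pow, norm_pow, Real.norm_of_nonneg h3.le,
      Real.norm_of_nonneg h4.le, Real.norm_eq_abs, pow_succ]
    field_simp
  simp_rw [h]
  have hinv (C : ℝ) : Tendsto (fun k : ℕ => ((k : ℝ) + C)⁻¹) atTop (𝓝 0) :=
    (tendsto_atTop_add_const_right _ _ tendsto_natCast_atTop_atTop).inv_tendsto_atTop
  simpa using ((hinv A).mul (hinv B)).const_mul |y|

lemma lommelSeries_comm (A B y : ℝ) : lommelSeries A B y = lommelSeries B A y := by
  simp only [lommelSeries, mul_comm]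

open Metric in
/-- The contiguity relation `y E_{A,B}' = E_{A,B-1} - (B - 1) E_{A,B}`. -/
lemma exists_hasDerivAt_lommelSeries {A B : ℝ} (hA : 0 < A) (hB : 1 < B) (y : ℝ) :
    ∃ D, HasDerivAt (lommelSeries A B) D y ∧
      y * D = lommelSeries A (B - 1) y - (B - 1) * lommelSeries A B y := by
  have hB0 : 0 < B := by linarith
  have hGA (k : ℕ) : 0 < Real.Gamma (k + A) := Real.Gamma_pos_of_pos (by positivity)
  have hGB (k : ℕ) : 0 < Real.Gamma (k + B) := Real.Gamma_pos_of_pos (by positivity)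
  have hGB' (k : ℕ) : 0 < Real.Gamma (k + (B - 1)) :=
    Real.Gamma_pos_of_pos (by have := k.cast_nonneg (α := ℝ); linarith)
  set R : ℝ := |y| + 1 with hR
  have hR1 : 1 ≤ R := by have := abs_nonneg y; linarith
  -- on the ball of radius `R` the termwise derivatives are dominated, as
  -- `k * R ^ (k - 1) ≤ (2 * R) ^ k`
  refine ⟨∑' k : ℕ, (k * y ^ (k - 1)) / (Real.Gamma (k + A) * Real.Gamma (k + B)), ?_, ?_⟩
  · refine hasDerivAt_tsum_of_isPreconnected (t := ball 0 R) (y₀ := 0)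
      (g := fun (k : ℕ) y => y ^ k / (Real.Gamma (k + A) * Real.Gamma (k + B)))
      (g' := fun (k : ℕ) y => (k * y ^ (k - 1)) / (Real.Gamma (k + A) * Real.Gamma (k + B)))
      (summable_lommelSeries hA hB0 (2 * R)) isOpen_ball (convex_ball _ _).isPreconnected
      (fun k z _ => (hasDerivAt_pow k z).div_const _) (fun k z hz => ?_)
      (mem_ball_self (by linarith)) (summable_lommelSeries hA hB0 0) (by simp [hR])
    have := mul_pos (hGA k) (hGB k)
    rw [norm_div, Real.norm_of_nonneg this.le, norm_mul, norm_pow, mul_pow,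
      Real.norm_of_nonneg k.cast_nonneg]
    have hz' : ‖z‖ ≤ R := by simpa using (mem_ball.1 hz).le
    have hk : (k : ℝ) ≤ 2 ^ k := by exact_mod_cast k.lt_two_pow_self.le
    gcongr
    exact (pow_le_pow_left₀ (norm_nonneg _) hz' _).trans (pow_le_pow_right₀ hR1 (by omega))
  · rw [lommelSeries, lommelSeries, ← tsum_mul_left, ← tsum_mul_left,
      ← (summable_lommelSeries hA (by linarith) y).tsum_sub
        ((summable_lommelSeries hA hB0 y).mul_left _)]
    refine tsum_congr fun k => ?_
    have hkB : 0 < (k : ℝ) + (B - 1) := by have := k.cast_nonneg (α := ℝ); linarith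
    have e : Real.Gamma (k + B) = (k + (B - 1)) * Real.Gamma (k + (B - 1)) := by
      rw [← Real.Gamma_add_one hkB.ne']; congr 1; ring
    have e2 : y * (k * y ^ (k - 1)) = k * y ^ k := by
      rcases k with _ | k
      · simp
      · rw [Nat.add_sub_cancel, pow_succ]; ring
    have := hGA k
    have := hGB' k
    rw [← mul_div_assoc, e2, e]
    field_simp
    ring

lemma lommelSeries_eq_add {A B : ℝ} (hA : 0 < A) (hB : 0 < B) (y : ℝ) :
    lommelSeries A B y =
      1 / (Real.Gamma A * Real.Gamma B) + y * lommelSeries (A + 1) (B + 1) y := by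
  rw [lommelSeries, (summable_lommelSeries hA hB y).tsum_eq_zero_add, lommelSeries, ← tsum_mul_left]
  congr 1
  · simp
  · refine tsum_congr fun k => ?_
    rw [pow_succ', mul_div_assoc]
    push_cast
    rw [add_assoc, add_comm 1 A, add_assoc, add_comm 1 B]

lemma continuous_lommelSeries {A B : ℝ} (hA : 0 < A) (hB : 1 < B) :
    Continuous (lommelSeries A B) :=
  continuous_iff_continuousAt.2 fun y =>
    (exists_hasDerivAt_lommelSeries hA hB y).choose_spec.1.continuousAt

lemma lommelT_eq (μ ν : ℝ) {x : ℝ} (hx : 0 < x) :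
    lommelT μ ν x = (x / 2) ^ (μ + 1) *
      lommelSeries ((μ - ν + 3) / 2) ((μ + ν + 3) / 2) ((x / 2) ^ 2) := by
  rw [lommelT, lommelSeries, ← tsum_mul_left]
  refine tsum_congr fun k => ?_
  rw [show μ + 2 * (k : ℝ) + 1 = (μ + 1) + ((2 * k : ℕ) : ℝ) by push_cast; ring,
    Real.rpow_add (by positivity), Real.rpow_natCast, pow_mul, mul_div_assoc]

lemma lommelG_eq {a b x : ℝ} (hx : 0 < x) :
    lommelG (a + b - 1) (b - a) x = x * (besselK (b - a) x * ((x / 2) ^ (a + b - 1) *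
        lommelSeries (a + 1) b ((x / 2) ^ 2)) +
      besselK (b - a - 1) x * ((x / 2) ^ (a + b - 1) * (x / 2) *
        lommelSeries (a + 1) (b + 1) ((x / 2) ^ 2))) := by
  rw [lommelG, lommelT_eq _ _ hx, lommelT_eq _ _ hx, Real.rpow_add_one (by positivity) (a + b - 1)]
  ring_nf

/-- The function `G_{μ,ν}` is, up to normalisation, a primitive of `x ^ μ K_ν(x)`; here
`μ = a + b - 1` and `ν = b - a`. -/
lemma hasDerivAt_lommelG {a b x : ℝ} (ha : 0 < a) (hb : 0 < b) (hx : 0 < x) :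
    HasDerivAt (lommelG (a + b - 1) (b - a))
      ((2 ^ (a + b - 2) * Real.Gamma a * Real.Gamma b)⁻¹ *
        (x ^ (a + b - 1) * besselK (b - a) x)) x := by
  have hga := Real.Gamma_pos_of_pos ha
  have hgb := Real.Gamma_pos_of_pos hb
  obtain ⟨D1, hD1, h1⟩ := exists_hasDerivAt_lommelSeries (A := b) (B := a + 1) hb (by linarith)
    ((x / 2) ^ 2)
  obtain ⟨D2, hD2, h2⟩ := exists_hasDerivAt_lommelSeries (A := a + 1) (B := b + 1) (by linarith)
    (by linarith) ((x / 2) ^ 2)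
  -- the index shift `lommelSeries_eq_add` turns `h1` into a relation between the two series that
  -- occur in `G`
  rw [add_sub_cancel_right] at h1 h2
  rw [lommelSeries_comm b a, lommelSeries_eq_add ha hb, lommelSeries_comm b] at h1
  simp_rw [funext (lommelSeries_comm b (a + 1))] at hD1
  have hlin : HasDerivAt (fun x : ℝ => x / 2) (1 / 2) x := (hasDerivAt_id x).div_const 2
  have hy : HasDerivAt (fun x : ℝ => (x / 2) ^ 2) (x / 2) x := by
    refine (hlin.pow 2).congr_deriv ?_
    norm_num
    ring
  have hP : HasDerivAt (fun x : ℝ => (x / 2) ^ (a + b - 1))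
      ((a + b - 1) / x * (x / 2) ^ (a + b - 1)) x := by
    refine (hlin.rpow_const (p := a + b - 1) (Or.inl (by positivity))).congr_deriv ?_
    rw [Real.rpow_sub_one (by positivity)]
    field_simp
  have hE1 := hD1.comp x hy
  have hE2 := hD2.comp x hy
  have hK := hasDerivAt_besselK (b - a) hx
  have hK1 := hasDerivAt_besselK_sub_one (b - a) hx
  have key := (hasDerivAt_id x).mul ((hK.mul (hP.mul hE1)).add (hK1.mul ((hP.mul hlin).mul hE2)))
  have heq : lommelG (a + b - 1) (b - a) =ᶠ[nhds x] fun x =>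
      x * (besselK (b - a) x * ((x / 2) ^ (a + b - 1) *
        lommelSeries (a + 1) b ((x / 2) ^ 2)) +
      besselK (b - a - 1) x * ((x / 2) ^ (a + b - 1) * (x / 2) *
        lommelSeries (a + 1) (b + 1) ((x / 2) ^ 2))) := by
    filter_upwards [lt_mem_nhds hx] with z hz using lommelG_eq hz
  refine HasDerivAt.congr_of_eventuallyEq (HasDerivAt.congr_deriv key ?_) heq
  have e1 : (2 : ℝ) ^ (a + b - 2) = 2 ^ (a + b - 1) / 2 := by
    rw [← Real.rpow_sub_one two_ne_zero]; congr 1; ring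
  have e2 : x ^ (a + b - 1) = 2 ^ (a + b - 1) * (x / 2) ^ (a + b - 1) := by
    rw [← Real.mul_rpow (by norm_num) (by positivity)]; congr 1; ring
  have h2p : (0 : ℝ) < 2 ^ (a + b - 1) := by positivity
  simp only [id_eq, Function.comp, Pi.mul_apply, Pi.add_apply]
  rw [e1, e2]
  generalize (x / 2) ^ (a + b - 1) = P at *
  generalize (2 : ℝ) ^ (a + b - 1) = Q at *
  generalize besselK (b - a) x = K at *
  generalize besselK (b - a - 1) x = K1 at *
  generalize lommelSeries (a + 1) b ((x / 2) ^ 2) = s1 at *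
  generalize lommelSeries (a + 1) (b + 1) ((x / 2) ^ 2) = s2 at *
  have hR : (Q / 2 * Real.Gamma a * Real.Gamma b)⁻¹ * (Q * P * K) =
      2 * P * K * (1 / (Real.Gamma a * Real.Gamma b)) := by field_simp
  rw [hR]
  generalize 1 / (Real.Gamma a * Real.Gamma b) = c at *
  field_simp
  field_simp at h1 h2
  linear_combination 2 * P * K * h1 + P * x * K1 * h2

open Filter Topology Set in
lemma tendsto_rpow_mul_besselK {p ν : ℝ} (h : |ν| < p) :
    Tendsto (fun x => x ^ p * besselK ν x) (𝓝[>] 0) (𝓝 0) := by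
  obtain ⟨a, ha1, ha2⟩ := exists_between h
  have ha : 0 < a := (abs_nonneg ν).trans_lt ha1
  have hlim : Tendsto (fun x : ℝ => Real.Gamma a * 2 ^ a * x ^ (p - a)) (𝓝[>] 0) (𝓝 0) := by
    have h1 : Tendsto (fun x : ℝ => x ^ (p - a)) (𝓝[>] 0) (𝓝 ((0 : ℝ) ^ (p - a))) :=
      ((Real.continuous_rpow_const (by linarith)).tendsto 0).mono_left nhdsWithin_le_nhds
    rw [Real.zero_rpow (by linarith)] at h1
    simpa using h1.const_mul (Real.Gamma a * 2 ^ a)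
  refine squeeze_zero' ?_ ?_ hlim
  · filter_upwards [self_mem_nhdsWithin] with x hx
    have hx : 0 < x := hx
    have := besselK_nonneg ν x
    positivity
  · filter_upwards [self_mem_nhdsWithin] with x hx
    have hx : 0 < x := hx
    calc x ^ p * besselK ν x ≤ x ^ p * (Real.Gamma a * 2 ^ a * x ^ (-a)) := by
          gcongr
          exact besselK_le_rpow hx ha ha1.le
      _ = _ := by rw [sub_eq_add_neg, Real.rpow_add hx]; ring

@[simp] lemma lommelG_zero (μ ν : ℝ) : lommelG μ ν 0 = 0 := by simp [lommelG]

open Filter Topology Set in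
lemma tendsto_lommelG_zero {a b : ℝ} (ha : 0 < a) (hb : 0 < b) :
    Tendsto (lommelG (a + b - 1) (b - a)) (𝓝[>] 0) (𝓝 0) := by
  have hc1 : Continuous (lommelSeries (a + 1) b) := by
    rw [funext (lommelSeries_comm (a + 1) b)]
    exact continuous_lommelSeries hb (by linarith)
  have hc2 : Continuous (lommelSeries (a + 1) (b + 1)) :=
    continuous_lommelSeries (by linarith) (by linarith)
  have hs : ∀ f : ℝ → ℝ, Continuous f →
      Tendsto (fun x : ℝ => f ((x / 2) ^ 2)) (𝓝[>] 0) (𝓝 (f ((0 / 2) ^ 2))) := fun f hf =>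
    ((hf.comp (by fun_prop : Continuous fun x : ℝ => (x / 2) ^ 2)).tendsto 0).mono_left
      nhdsWithin_le_nhds
  have t1 := (tendsto_rpow_mul_besselK (p := a + b) (ν := b - a)
    (by rw [abs_lt]; constructor <;> linarith)).mul (hs _ hc1)
  have t2 := (tendsto_rpow_mul_besselK (p := a + b + 1) (ν := b - a - 1)
    (by rw [abs_lt]; constructor <;> linarith)).mul (hs _ hc2)
  have t := (t1.const_mul ((1 / 2) ^ (a + b - 1))).add (t2.const_mul ((1 / 2) ^ (a + b)))
  simp only [zero_mul, mul_zero, add_zero] at t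
  refine t.congr' ?_
  filter_upwards [self_mem_nhdsWithin] with x hx
  have hx : 0 < x := hx
  have e2 : (x / 2) ^ (a + b - 1) = (1 / 2) ^ (a + b - 1) * x ^ (a + b - 1) := by
    rw [← Real.mul_rpow (by norm_num) hx.le]; congr 1; ring
  rw [lommelG_eq hx, e2, Real.rpow_add_one hx.ne' (a + b), Real.rpow_sub_one (by norm_num),
    Real.rpow_sub_one hx.ne']
  field_simp

open Set in
lemma integrableOn_rpow_mul_besselK {μ ν : ℝ} (h1 : 0 < μ - ν + 1) (h2 : 0 < μ + ν + 1) :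
    IntegrableOn (fun x => x ^ μ * besselK ν x) (Ioi 0) := by
  have hm : Measurable (fun x : ℝ => x ^ μ * besselK ν x) :=
    (by fun_prop : Measurable fun x : ℝ => x ^ μ).mul (measurable_besselK ν)
  refine ⟨hm.aestronglyMeasurable, ?_⟩
  rw [hasFiniteIntegral_iff_ofReal, lintegral_rpow_mul_besselK h1 h2]
  · exact ENNReal.ofReal_lt_top
  · filter_upwards [self_mem_ae_restrict measurableSet_Ioi] with x hx
    exact mul_nonneg (Real.rpow_nonneg (le_of_lt hx) _) (besselK_nonneg _ _)

open Set in
lemma integral_rpow_mul_besselK {μ ν : ℝ} (h1 : 0 < μ - ν + 1) (h2 : 0 < μ + ν + 1) :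
    ∫ x in Ioi (0 : ℝ), x ^ μ * besselK ν x =
      2 ^ (μ - 1) * Real.Gamma ((μ - ν + 1) / 2) * Real.Gamma ((μ + ν + 1) / 2) := by
  have hG1 := Real.Gamma_pos_of_pos (half_pos h1)
  have hG2 := Real.Gamma_pos_of_pos (half_pos h2)
  rw [integral_eq_lintegral_of_nonneg_ae _ (integrableOn_rpow_mul_besselK h1 h2).1,
    lintegral_rpow_mul_besselK h1 h2, ENNReal.toReal_ofReal (by positivity)]
  filter_upwards [self_mem_ae_restrict measurableSet_Ioi] with x hx
  exact mul_nonneg (Real.rpow_nonneg (le_of_lt hx) _) (besselK_nonneg _ _)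

open Set in
lemma integral_Ioc_rpow_mul_besselK {μ ν x : ℝ} (h1 : 0 < μ - ν + 1) (h2 : 0 < μ + ν + 1)
    (hx : 0 ≤ x) :
    ∫ t in Ioc 0 x, t ^ μ * besselK ν t =
      2 ^ (μ - 1) * Real.Gamma ((μ - ν + 1) / 2) * Real.Gamma ((μ + ν + 1) / 2) *
        lommelG μ ν x := by
  -- the parametrisation `μ = a + b - 1`, `ν = b - a` of the derivative formula
  obtain ⟨a, ha⟩ : ∃ a, a = (μ - ν + 1) / 2 := ⟨_, rfl⟩
  obtain ⟨b, hb⟩ : ∃ b, b = (μ + ν + 1) / 2 := ⟨_, rfl⟩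
  have ha0 : 0 < a := by linarith
  have hb0 : 0 < b := by linarith
  have hint := integrableOn_rpow_mul_besselK h1 h2
  rw [← ha, ← hb]
  obtain rfl : μ = a + b - 1 := by linarith
  obtain rfl : ν = b - a := by linarith
  have hga := Real.Gamma_pos_of_pos ha0
  have hgb := Real.Gamma_pos_of_pos hb0
  have hcont : ContinuousOn (lommelG (a + b - 1) (b - a)) (Icc 0 x) := by
    intro y hy
    rcases hy.1.eq_or_lt with rfl | hy0
    · have h : ContinuousWithinAt (lommelG (a + b - 1) (b - a)) (Ioi 0) 0 := by
        rw [ContinuousWithinAt, lommelG_zero]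
        exact tendsto_lommelG_zero ha0 hb0
      exact (continuousWithinAt_Ioi_iff_Ici.1 h).mono Icc_subset_Ici_self
    · exact (hasDerivAt_lommelG ha0 hb0 hy0).continuousAt.continuousWithinAt
  have hi : IntervalIntegrable (fun t => (2 ^ (a + b - 2) * Real.Gamma a * Real.Gamma b)⁻¹ *
      (t ^ (a + b - 1) * besselK (b - a) t)) volume 0 x := by
    rw [intervalIntegrable_iff_integrableOn_Ioc_of_le hx]
    exact (hint.mono_set Ioc_subset_Ioi_self).const_mul _
  have key := intervalIntegral.integral_eq_sub_of_hasDerivAt_of_le hx hcont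
    (fun y hy => hasDerivAt_lommelG ha0 hb0 hy.1) hi
  rw [lommelG_zero, sub_zero, intervalIntegral.integral_const_mul,
    intervalIntegral.integral_of_le hx] at key
  rw [← key, show a + b - 1 - 1 = a + b - 2 by ring, ← mul_assoc, mul_inv_cancel₀ (by positivity),
    one_mul]

open Set in
lemma integral_Ioi_rpow_mul_besselK {μ ν x : ℝ} (h1 : 0 < μ - ν + 1) (h2 : 0 < μ + ν + 1)
    (hx : 0 ≤ x) :
    ∫ t in Ioi x, t ^ μ * besselK ν t =
      2 ^ (μ - 1) * Real.Gamma ((μ - ν + 1) / 2) * Real.Gamma ((μ + ν + 1) / 2) *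
        lommelGTilde μ ν x := by
  have hint := integrableOn_rpow_mul_besselK h1 h2
  have h := setIntegral_union (Ioc_disjoint_Ioi (le_refl x)) measurableSet_Ioi
    (hint.mono_set Ioc_subset_Ioi_self) (hint.mono_set (Ioi_subset_Ioi hx))
  rw [Ioc_union_Ioi_eq_Ioi hx, integral_rpow_mul_besselK h1 h2,
    integral_Ioc_rpow_mul_besselK h1 h2 hx] at h
  rw [lommelGTilde]
  linarith

/-! ### Total mass and moment generating function of the variance-gamma law -/

lemma lintegral_exp_mul_sub_sq (β : ℝ) {v : ℝ} (hv : 0 < v) :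
    ∫⁻ x : ℝ, ENNReal.ofReal (Real.exp (β * x - x ^ 2 / (2 * v))) =
      ENNReal.ofReal (Real.sqrt (2 * Real.pi * v) * Real.exp (β ^ 2 * v / 2)) := by
  have h0 : ∫⁻ x : ℝ, ENNReal.ofReal (Real.exp (-(1 / (2 * v)) * x ^ 2)) =
      ENNReal.ofReal (Real.sqrt (2 * Real.pi * v)) := by
    rw [← ofReal_integral_eq_lintegral_ofReal (integrable_exp_neg_mul_sq (by positivity))
      (ae_of_all _ fun x => (Real.exp_pos _).le), integral_gaussian]
    congr 2
    field_simp
  have h1 := lintegral_sub_right_eq_self (μ := volume)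
    (fun x : ℝ => ENNReal.ofReal (Real.exp (-(1 / (2 * v)) * x ^ 2))) (β * v)
  rw [mul_comm (Real.sqrt _), ENNReal.ofReal_mul (Real.exp_pos _).le, ← h0, ← h1,
    ← lintegral_const_mul _ (by fun_prop)]
  congr 1 with x
  rw [← ENNReal.ofReal_mul (Real.exp_pos _).le, ← Real.exp_add]
  congr 2
  field_simp
  ring

lemma measurable_vgPDF (ν α β μ : ℝ) : Measurable (vgPDF ν α β μ) := by
  have := (measurable_besselK ν).comp (by fun_prop : Measurable fun x : ℝ => α * |x - μ|)
  unfold vgPDF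
  exact Measurable.mul (by fun_prop) this

lemma vgPDF_nonneg {ν α β : ℝ} (hν : -(1 / 2) < ν) (hβ : |β| < α) (μ x : ℝ) :
    0 ≤ vgPDF ν α β μ x := by
  have hα : 0 < α := (abs_nonneg β).trans_lt hβ
  have h1 : 0 < α ^ 2 - β ^ 2 := sub_pos.2 (sq_lt_sq' (abs_lt.1 hβ).1 (abs_lt.1 hβ).2)
  have h2 := Real.Gamma_pos_of_pos (show 0 < ν + 1 / 2 by linarith)
  have h3 := besselK_nonneg ν (α * |x - μ|)
  unfold vgPDF
  positivity

open Set in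
/-- The variance-gamma density has total mass one, by writing it as a mixture of Gaussian
densities. -/
lemma lintegral_vgPDF {ν α β : ℝ} (hν : -(1 / 2) < ν) (hβ : |β| < α) :
    ∫⁻ x, ENNReal.ofReal (vgPDF ν α β 0 x) = 1 := by
  have hα : 0 < α := (abs_nonneg β).trans_lt hβ
  have h1 : 0 < α ^ 2 - β ^ 2 := sub_pos.2 (sq_lt_sq' (abs_lt.1 hβ).1 (abs_lt.1 hβ).2)
  have h2 := Real.Gamma_pos_of_pos (show 0 < ν + 1 / 2 by linarith)
  obtain ⟨C, hC⟩ : ∃ C, C = (α ^ 2 - β ^ 2) ^ (ν + 1 / 2) /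
    (Real.sqrt Real.pi * (2 * α) ^ ν * Real.Gamma (ν + 1 / 2)) := ⟨_, rfl⟩
  have hC0 : 0 ≤ C := by rw [hC]; positivity
  have step1 : ∀ᵐ x : ℝ, ENNReal.ofReal (vgPDF ν α β 0 x) =
      ∫⁻ s in Ioi (0 : ℝ),
        ENNReal.ofReal (C * (1 / 2) * (α / 2) ^ (-ν) * (s ^ (ν - 1) * Real.exp (-s))) *
        ENNReal.ofReal (Real.exp (β * x - x ^ 2 / (2 * (2 * s / α ^ 2)))) := by
    filter_upwards [compl_mem_ae_iff.2 (measure_singleton (0 : ℝ))] with x hx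
    have hx : 0 < |x| := abs_pos.2 hx
    -- using `K_{-ν}` for `K_ν`, the factor `(α * |x| / 2) ^ (-ν)` cancels `|x| ^ ν`
    rw [vgPDF, sub_zero, ← hC, ENNReal.ofReal_mul (by positivity), ← besselK_neg,
      ofReal_besselK_eq_lintegral_rpow (-ν) (by positivity), ← mul_assoc,
      ← lintegral_const_mul _ (by fun_prop)]
    refine setLIntegral_congr_fun measurableSet_Ioi fun s hs => ?_
    have hs : 0 < s := hs
    rw [← ENNReal.ofReal_mul (by positivity), ← ENNReal.ofReal_mul (by positivity),
      ← ENNReal.ofReal_mul (by positivity), sub_eq_add_neg (-s), sub_eq_add_neg (β * x),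
      Real.exp_add, Real.exp_add, neg_neg,
      show α * |x| / 2 = (α / 2) * |x| by ring, Real.mul_rpow (by positivity) (by positivity),
      mul_pow, sq_abs,
      show -(α ^ 2 * x ^ 2 / (4 * s)) = -(x ^ 2 / (2 * (2 * s / α ^ 2))) by field_simp; norm_num]
    congr 1
    have h3 : |x| ^ ν * |x| ^ (-ν) = 1 := by rw [← Real.rpow_add hx, add_neg_cancel, Real.rpow_zero]
    linear_combination (C * Real.exp (β * x) * (1 / 2) * (α / 2) ^ (-ν) * (s ^ (ν - 1) *
      Real.exp (-s)) * Real.exp (-(x ^ 2 / (2 * (2 * s / α ^ 2))))) * h3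
  have step2 : ∀ s ∈ Ioi (0 : ℝ), (∫⁻ x : ℝ,
      ENNReal.ofReal (C * (1 / 2) * (α / 2) ^ (-ν) * (s ^ (ν - 1) * Real.exp (-s))) *
        ENNReal.ofReal (Real.exp (β * x - x ^ 2 / (2 * (2 * s / α ^ 2))))) =
      ENNReal.ofReal (C * (1 / 2) * (α / 2) ^ (-ν) * (2 * Real.sqrt Real.pi / α)) *
      ENNReal.ofReal (s ^ (ν + 1 / 2 - 1) * Real.exp (-((α ^ 2 - β ^ 2) / α ^ 2 * s))) := by
    intro s hs
    have hs : 0 < s := hs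
    rw [lintegral_const_mul _ (by fun_prop), lintegral_exp_mul_sub_sq β (by positivity),
      ← ENNReal.ofReal_mul (by positivity), ← ENNReal.ofReal_mul (by positivity)]
    congr 1
    have e1 : Real.sqrt (2 * Real.pi * (2 * s / α ^ 2)) =
        2 * Real.sqrt Real.pi / α * s ^ (1 / 2 : ℝ) := by
      rw [← Real.sqrt_eq_rpow, show 2 * Real.pi * (2 * s / α ^ 2) = (2 / α) ^ 2 * (Real.pi * s) by
        ring, Real.sqrt_mul (by positivity), Real.sqrt_sq (by positivity),
        Real.sqrt_mul (by positivity)]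
      ring
    have e2 : s ^ (ν + 1 / 2 - 1) = s ^ (ν - 1) * s ^ (1 / 2 : ℝ) := by
      rw [← Real.rpow_add hs]; congr 1; ring
    have e3 : Real.exp (-((α ^ 2 - β ^ 2) / α ^ 2 * s)) =
        Real.exp (-s) * Real.exp (β ^ 2 * (2 * s / α ^ 2) / 2) := by
      rw [← Real.exp_add]; congr 1; field_simp; ring
    rw [e1, e2, e3]
    ring
  rw [lintegral_congr_ae step1, lintegral_lintegral_swap,
    setLIntegral_congr_fun measurableSet_Ioi step2, lintegral_const_mul _ (by fun_prop),
    lintegral_rpow_mul_exp_neg_mul (by linarith) (by positivity),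
    ← ENNReal.ofReal_mul (by positivity), ← ENNReal.ofReal_one]
  · congr 1
    have e1 : (1 / ((α ^ 2 - β ^ 2) / α ^ 2)) ^ (ν + 1 / 2) =
        α ^ ν * α ^ ν * α / (α ^ 2 - β ^ 2) ^ (ν + 1 / 2) := by
      rw [one_div_div, Real.div_rpow (by positivity) h1.le, ← Real.rpow_natCast,
        ← Real.rpow_mul hα.le,
        show ((2 : ℕ) : ℝ) * (ν + 1 / 2) = ν + ν + 1 by push_cast; ring, Real.rpow_add hα,
        Real.rpow_add hα, Real.rpow_one]
    have e2 : (α / 2) ^ (-ν) = 2 ^ ν / α ^ ν := by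
      rw [Real.rpow_neg (by positivity), Real.div_rpow hα.le zero_le_two, inv_div]
    have h3 : 0 < (α ^ 2 - β ^ 2) ^ (ν + 1 / 2) := by positivity
    have h4 : 0 < α ^ ν := by positivity
    have h5 : (0 : ℝ) < 2 ^ ν := by positivity
    rw [e1, e2, hC, Real.mul_rpow zero_le_two hα.le]
    generalize (α ^ 2 - β ^ 2) ^ (ν + 1 / 2) = X at *
    generalize α ^ ν = Y at *
    generalize Real.Gamma (ν + 1 / 2) = g at *
    generalize (2 : ℝ) ^ ν = W at *
    field_simp
  · apply Measurable.aemeasurable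
    unfold Function.uncurry
    fun_prop

lemma isProbabilityMeasure_vgMeasure {ν α β : ℝ} (hν : -(1 / 2) < ν) (hβ : |β| < α) :
    IsProbabilityMeasure (vgMeasure ν α β 0) :=
  ⟨by rw [vgMeasure, withDensity_apply _ MeasurableSet.univ, setLIntegral_univ,
    lintegral_vgPDF hν hβ]⟩

lemma exp_mul_vgPDF {ν α β t : ℝ} (hβ : |β| < α) (ht : |β + t| < α) (x : ℝ) :
    Real.exp (t * x) * vgPDF ν α β 0 x =
      ((α ^ 2 - β ^ 2) / (α ^ 2 - (β + t) ^ 2)) ^ (ν + 1 / 2) * vgPDF ν α (β + t) 0 x := by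
  have h1 : 0 < α ^ 2 - β ^ 2 := sub_pos.2 (sq_lt_sq' (abs_lt.1 hβ).1 (abs_lt.1 hβ).2)
  have h2 : 0 < α ^ 2 - (β + t) ^ 2 := sub_pos.2 (sq_lt_sq' (abs_lt.1 ht).1 (abs_lt.1 ht).2)
  have h3 : 0 < (α ^ 2 - (β + t) ^ 2) ^ (ν + 1 / 2) := by positivity
  rw [vgPDF, vgPDF, sub_zero, Real.div_rpow h1.le h2.le, add_mul, Real.exp_add]
  field_simp

/-- Multiplying the density by `exp (t * x)` shifts `β` to `β + t`, whence the moment generating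
function. -/
lemma lintegral_exp_vgMeasure {ν α β t : ℝ} (hν : -(1 / 2) < ν) (hβ : |β| < α)
    (ht : |β + t| < α) :
    ∫⁻ x, ENNReal.ofReal (Real.exp (t * x)) ∂(vgMeasure ν α β 0) =
      ENNReal.ofReal (((α ^ 2 - β ^ 2) / (α ^ 2 - (β + t) ^ 2)) ^ (ν + 1 / 2)) := by
  have h1 : 0 < α ^ 2 - β ^ 2 := sub_pos.2 (sq_lt_sq' (abs_lt.1 hβ).1 (abs_lt.1 hβ).2)
  have h2 : 0 < α ^ 2 - (β + t) ^ 2 := sub_pos.2 (sq_lt_sq' (abs_lt.1 ht).1 (abs_lt.1 ht).2)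
  rw [vgMeasure, lintegral_withDensity_eq_lintegral_mul _ (measurable_vgPDF _ _ _ _).ennreal_ofReal
    (by fun_prop)]
  simp only [Pi.mul_apply]
  have h (x : ℝ) : ENNReal.ofReal (vgPDF ν α β 0 x) * ENNReal.ofReal (Real.exp (t * x)) =
      ENNReal.ofReal (((α ^ 2 - β ^ 2) / (α ^ 2 - (β + t) ^ 2)) ^ (ν + 1 / 2)) *
        ENNReal.ofReal (vgPDF ν α (β + t) 0 x) := by
    rw [← ENNReal.ofReal_mul (vgPDF_nonneg hν hβ _ _), mul_comm, exp_mul_vgPDF hβ ht,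
      ENNReal.ofReal_mul (by positivity)]
  simp_rw [h]
  rw [lintegral_const_mul _ (measurable_vgPDF _ _ _ _).ennreal_ofReal, lintegral_vgPDF hν ht,
    mul_one]

lemma integrable_exp_of_lintegral_eq {Ω : Type*} [MeasurableSpace Ω] {P : Measure Ω} {X : Ω → ℝ}
    {t c : ℝ} (hX : AEMeasurable X P)
    (h : ∫⁻ ω, ENNReal.ofReal (Real.exp (t * X ω)) ∂P = ENNReal.ofReal c) :
    Integrable (fun ω => Real.exp (t * X ω)) P := by
  refine ⟨(aemeasurable_exp_mul t hX), ?_⟩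
  rw [hasFiniteIntegral_iff_ofReal (ae_of_all _ fun _ => (Real.exp_pos _).le), h]
  exact ENNReal.ofReal_lt_top

lemma mgf_of_lintegral_eq {Ω : Type*} [MeasurableSpace Ω] {P : Measure Ω} {X : Ω → ℝ}
    {t c : ℝ} (hX : AEMeasurable X P) (hc : 0 ≤ c)
    (h : ∫⁻ ω, ENNReal.ofReal (Real.exp (t * X ω)) ∂P = ENNReal.ofReal c) :
    mgf X P t = c := by
  rw [mgf, integral_eq_lintegral_of_nonneg_ae (ae_of_all _ fun _ => (Real.exp_pos _).le)
    (aemeasurable_exp_mul t hX), h, ENNReal.toReal_ofReal hc]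

/-! ### The law of the mean of independent normal products -/

open Filter Topology Complex in
/-- Two probability measures whose moment generating functions are finite and agree near zero are
equal: the complex moment generating functions are analytic on a strip around the imaginary axis. -/
theorem ext_of_mgf_eqOn {μ μ' : Measure ℝ} [IsProbabilityMeasure μ] [IsProbabilityMeasure μ']
    {r : ℝ} (hr : 0 < r) (hμ : ∀ t, |t| < r → Integrable (fun x => Real.exp (t * x)) μ)
    (hμ' : ∀ t, |t| < r → Integrable (fun x => Real.exp (t * x)) μ')
    (h : ∀ t, |t| < r → mgf id μ t = mgf id μ' t) : μ = μ' := by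
  have hball : Metric.ball (0 : ℝ) r ⊆ interior (integrableExpSet id μ) :=
    interior_maximal (fun t ht => hμ t (by simpa using ht)) Metric.isOpen_ball
  have hball' : Metric.ball (0 : ℝ) r ⊆ interior (integrableExpSet id μ') :=
    interior_maximal (fun t ht => hμ' t (by simpa using ht)) Metric.isOpen_ball
  have hX : AnalyticOnNhd ℂ (complexMGF id μ) {z | z.re ∈ Metric.ball (0 : ℝ) r} :=
    analyticOnNhd_complexMGF.mono fun z hz => hball hz
  have hY : AnalyticOnNhd ℂ (complexMGF id μ') {z | z.re ∈ Metric.ball (0 : ℝ) r} :=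
    analyticOnNhd_complexMGF.mono fun z hz => hball' hz
  have heq : Set.EqOn (complexMGF id μ) (complexMGF id μ') {z | z.re ∈ Metric.ball (0 : ℝ) r} := by
    refine AnalyticOnNhd.eqOn_of_preconnected_of_frequently_eq hX hY
      ((convex_ball (0 : ℝ) r).linear_preimage reLm).isPreconnected
      (z₀ := ((0 : ℝ) : ℂ)) (by simp [hr]) ?_
    have h_real : ∃ᶠ x : ℝ in 𝓝[≠] 0, complexMGF id μ x = complexMGF id μ' x := by
      refine Eventually.frequently (eventually_nhdsWithin_of_eventually_nhds ?_)
      filter_upwards [Metric.ball_mem_nhds (0 : ℝ) hr] with x hx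
      rw [complexMGF_ofReal, complexMGF_ofReal, h x (by simpa using hx)]
    refine Tendsto.frequently ?_ h_real
    refine tendsto_nhdsWithin_iff.2 ⟨?_, ?_⟩
    · exact (continuous_ofReal.tendsto 0).mono_left nhdsWithin_le_nhds
    · filter_upwards [self_mem_nhdsWithin] with x hx
      simpa using hx
  refine Measure.ext_of_charFun (funext fun t => ?_)
  rw [← complexMGF_id_mul_I, ← complexMGF_id_mul_I]
  exact heq (by simp [hr])

lemma lintegral_exp_mul_gaussianReal (v : NNReal) (a : ℝ) :
    ∫⁻ w, ENNReal.ofReal (Real.exp (a * w)) ∂(gaussianReal 0 v) =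
      ENNReal.ofReal (Real.exp (v * a ^ 2 / 2)) := by
  rw [← ofReal_integral_eq_lintegral_ofReal (integrable_exp_mul_gaussianReal a)
    (ae_of_all _ fun _ => (Real.exp_pos _).le)]
  have h := congrFun (mgf_fun_id_gaussianReal (μ := 0) (v := v)) a
  rw [mgf] at h
  rw [h, zero_mul, zero_add]

lemma lintegral_exp_mul_sq_gaussianReal {v : NNReal} (hv : v ≠ 0) {κ : ℝ}
    (hκ : 0 < 1 - 2 * κ * v) :
    ∫⁻ u, ENNReal.ofReal (Real.exp (κ * u ^ 2)) ∂(gaussianReal 0 v) =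
      ENNReal.ofReal ((1 / (1 - 2 * κ * v)) ^ (1 / 2 : ℝ)) := by
  have hv' : (0 : ℝ) < v := by positivity
  rw [gaussianReal_of_var_ne_zero 0 hv, lintegral_withDensity_eq_lintegral_mul _
    (measurable_gaussianPDF _ _) (by fun_prop)]
  have h (u : ℝ) : gaussianPDF 0 v u * ENNReal.ofReal (Real.exp (κ * u ^ 2)) =
      ENNReal.ofReal (Real.sqrt (2 * Real.pi * v))⁻¹ *
        ENNReal.ofReal (Real.exp (0 * u - u ^ 2 / (2 * (v / (1 - 2 * κ * v))))) := by
    rw [gaussianPDF, gaussianPDFReal, ← ENNReal.ofReal_mul (by positivity),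
      ← ENNReal.ofReal_mul (by positivity), mul_assoc, ← Real.exp_add]
    congr 3
    field_simp
    ring
  simp only [Pi.mul_apply, h]
  rw [lintegral_const_mul _ (by fun_prop), lintegral_exp_mul_sub_sq 0 (by positivity),
    ← ENNReal.ofReal_mul (by positivity), ← Real.sqrt_eq_rpow,
    show 2 * Real.pi * (v / (1 - 2 * κ * v)) = (2 * Real.pi * v) * (1 / (1 - 2 * κ * v)) by ring,
    Real.sqrt_mul (show 0 ≤ 2 * Real.pi * (v : ℝ) by positivity)]
  congr 1
  have : 0 < Real.sqrt (2 * Real.pi * v) := by positivity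
  rw [mul_assoc (Real.sqrt _), inv_mul_cancel_left₀ this.ne']
  simp

/-- The moment generating function of the product of two centred jointly normal variables: `V` is
`c * U` plus a normal variable independent of `U`, so that integrating it out leaves a Gaussian
integral in `U`. -/
lemma lintegral_exp_mul_normal_product {Ω : Type*} [MeasurableSpace Ω] {P : Measure Ω}
    {σU σV ρ t : ℝ} (hσU : 0 < σU) (hρ : |ρ| < 1) {U V : Ω → ℝ}
    (hUV : HasGaussianLaw (fun ω => (U ω, V ω)) P)
    (hU0 : ∫ ω, U ω ∂P = 0) (hV0 : ∫ ω, V ω ∂P = 0)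
    (hU : variance U P = σU ^ 2) (hV : variance V P = σV ^ 2)
    (hcov : covariance U V P = ρ * σU * σV)
    (ht : 0 < 1 - 2 * ρ * (σU * σV) * t - (σU * σV) ^ 2 * (1 - ρ ^ 2) * t ^ 2) :
    ∫⁻ ω, ENNReal.ofReal (Real.exp (t * (U ω * V ω))) ∂P =
      ENNReal.ofReal ((1 / (1 - 2 * ρ * (σU * σV) * t -
        (σU * σV) ^ 2 * (1 - ρ ^ 2) * t ^ 2)) ^ (1 / 2 : ℝ)) := by
  have hP : IsProbabilityMeasure P := hUV.isProbabilityMeasure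
  have hUm := hUV.fst.memLp_two
  have hVm := hUV.snd.memLp_two
  -- the regression coefficient, which makes `V - c * U` uncorrelated with `U`
  obtain ⟨c, hc⟩ : ∃ c, c = ρ * σV / σU := ⟨_, rfl⟩
  have hcm : MemLp (fun ω => c * U ω) 2 P := hUm.const_mul c
  have hW : HasGaussianLaw (fun ω => (U ω, V ω - c * U ω)) P :=
    hUV.map_fun ((ContinuousLinearMap.fst ℝ ℝ ℝ).prod
      (ContinuousLinearMap.snd ℝ ℝ ℝ - c • ContinuousLinearMap.fst ℝ ℝ ℝ))
  have hUW : covariance U (fun ω => V ω - c * U ω) P = 0 := by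
    rw [covariance_fun_sub_right hUm hVm hcm, covariance_const_mul_right, hcov,
      covariance_self hUm.aemeasurable, hU, hc]
    field_simp
    ring
  have hWv : variance (fun ω => V ω - c * U ω) P = σV ^ 2 * (1 - ρ ^ 2) := by
    rw [variance_fun_sub hVm hcm, covariance_const_mul_right, covariance_comm, hcov,
      variance_const_mul, hU, hV, hc]
    field_simp
    ring
  have hW0 : ∫ ω, (V ω - c * U ω) ∂P = 0 := by
    rw [integral_sub (hVm.integrable (by norm_num)) (hcm.integrable (by norm_num)),
      integral_const_mul, hU0, hV0]
    ring
  have hind := hW.indepFun_of_covariance_eq_zero hUW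
  have hmap := (indepFun_iff_map_prod_eq_prod_map_map hW.fst.aemeasurable
    hW.snd.aemeasurable).1 hind
  rw [hW.fst.map_eq_gaussianReal, hW.snd.map_eq_gaussianReal, hWv, hW0, hU, hU0] at hmap
  have hρ2 : 0 < 1 - ρ ^ 2 := by
    have := sq_lt_one_iff_abs_lt_one ρ |>.2 hρ
    linarith
  have hf : Measurable (fun p : ℝ × ℝ => ENNReal.ofReal (Real.exp (t * (p.1 * (p.2 + c * p.1))))) :=
    by fun_prop
  have h1 : ∫⁻ ω, ENNReal.ofReal (Real.exp (t * (U ω * V ω))) ∂P =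
      ∫⁻ p, ENNReal.ofReal (Real.exp (t * (p.1 * (p.2 + c * p.1))))
        ∂(P.map fun ω => (U ω, V ω - c * U ω)) := by
    rw [lintegral_map' hf.aemeasurable hW.aemeasurable]
    simp only [sub_add_cancel]
  rw [h1, hmap, lintegral_prod _ hf.aemeasurable]
  have h2 (u : ℝ) : ∫⁻ w, ENNReal.ofReal (Real.exp (t * (u * (w + c * u))))
      ∂(gaussianReal 0 (σV ^ 2 * (1 - ρ ^ 2)).toNNReal) =
      ENNReal.ofReal (Real.exp ((t * c + σV ^ 2 * (1 - ρ ^ 2) * t ^ 2 / 2) * u ^ 2)) := by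
    have h3 (w : ℝ) : ENNReal.ofReal (Real.exp (t * (u * (w + c * u)))) =
        ENNReal.ofReal (Real.exp (t * c * u ^ 2)) * ENNReal.ofReal (Real.exp (t * u * w)) := by
      rw [← ENNReal.ofReal_mul (Real.exp_pos _).le, ← Real.exp_add]
      congr 2
      ring
    simp_rw [h3]
    rw [lintegral_const_mul _ (by fun_prop), lintegral_exp_mul_gaussianReal,
      ← ENNReal.ofReal_mul (Real.exp_pos _).le, ← Real.exp_add,
      Real.coe_toNNReal _ (by positivity)]
    congr 2
    ring
  simp_rw [h2]
  have hD : 1 - 2 * (t * c + σV ^ 2 * (1 - ρ ^ 2) * t ^ 2 / 2) * ((σU ^ 2).toNNReal : ℝ) =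
      1 - 2 * ρ * (σU * σV) * t - (σU * σV) ^ 2 * (1 - ρ ^ 2) * t ^ 2 := by
    rw [Real.coe_toNNReal _ (by positivity), hc]
    field_simp
    ring
  rw [lintegral_exp_mul_sq_gaussianReal (by simp [hσU.ne']) (by rw [hD]; exact ht), hD]

/-- The mean of `n` independent copies of the product of two centred jointly normal variables is
variance-gamma distributed. -/
theorem hasLaw_mean_normal_product
    {Ω₀ : Type*} [MeasurableSpace Ω₀] {P₀ : Measure Ω₀}
    {Ω : Type*} [MeasurableSpace Ω] {P : Measure Ω} [IsProbabilityMeasure P]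
    {σU σV ρ : ℝ} (hσU : 0 < σU) (hσV : 0 < σV) (hρ : |ρ| < 1) {U V : Ω₀ → ℝ}
    (hUV : HasGaussianLaw (fun ω => (U ω, V ω)) P₀)
    (hU0 : ∫ ω, U ω ∂P₀ = 0) (hV0 : ∫ ω, V ω ∂P₀ = 0)
    (hU : variance U P₀ = σU ^ 2) (hV : variance V P₀ = σV ^ 2)
    (hcov : covariance U V P₀ = ρ * σU * σV)
    {n : ℕ} (hn : 1 ≤ n) {Z : Fin n → Ω → ℝ} (hindep : iIndepFun Z P)
    (hident : ∀ i, IdentDistrib (Z i) (fun ω => U ω * V ω) P P₀) :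
    HasLaw (fun ω => (∑ i, Z i ω) / (n : ℝ))
      (vgMeasure (((n : ℝ) - 1) / 2) ((n : ℝ) / (σU * σV * (1 - ρ ^ 2)))
        ((n : ℝ) / (σU * σV * (1 - ρ ^ 2)) * ρ) 0) P := by
  have hn0 : (0 : ℝ) < n := by exact_mod_cast hn
  have hρ2 : 0 < 1 - ρ ^ 2 := by
    have := sq_lt_one_iff_abs_lt_one ρ |>.2 hρ
    linarith
  obtain ⟨α, hα⟩ : ∃ α, α = (n : ℝ) / (σU * σV * (1 - ρ ^ 2)) := ⟨_, rfl⟩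
  have hα0 : 0 < α := by rw [hα]; positivity
  rw [← hα]
  have hν : -(1 / 2) < ((n : ℝ) - 1) / 2 := by linarith
  have hβ : |α * ρ| < α := by
    rw [abs_mul, abs_of_pos hα0]
    exact mul_lt_of_lt_one_right hα0 hρ
  have hvg := isProbabilityMeasure_vgMeasure hν hβ
  have hZ (i) : AEMeasurable (Z i) P := (hident i).aemeasurable_fst
  have hsum : AEMeasurable (∑ i, Z i) P := Finset.aemeasurable_sum _ fun i _ => hZ i
  have hfun : (fun ω => (∑ i, Z i ω) / (n : ℝ)) = fun ω => (n : ℝ)⁻¹ * (∑ i, Z i) ω := by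
    ext ω; rw [Finset.sum_apply, div_eq_inv_mul]
  have hbar : AEMeasurable (fun ω => (∑ i, Z i ω) / (n : ℝ)) P := by
    rw [hfun]; exact hsum.const_mul _
  have hbound (t : ℝ) (ht : |t| < α - |α * ρ|) : |α * ρ + t| < α :=
    (abs_add_le _ _).trans_lt (by linarith)
  -- the quadratic of the product-normal law at `t / n` is that of the variance-gamma law at `t`
  have hquad (t : ℝ) : (α ^ 2 - (α * ρ + t) ^ 2) / (α ^ 2 - (α * ρ) ^ 2) =
      1 - 2 * ρ * (σU * σV) * ((n : ℝ)⁻¹ * t) -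
        (σU * σV) ^ 2 * (1 - ρ ^ 2) * ((n : ℝ)⁻¹ * t) ^ 2 := by
    have : α ^ 2 - (α * ρ) ^ 2 ≠ 0 := by
      rw [show α ^ 2 - (α * ρ) ^ 2 = α ^ 2 * (1 - ρ ^ 2) by ring]; positivity
    rw [div_eq_iff this, hα]
    field_simp
    ring
  have hpos1 : 0 < α ^ 2 - (α * ρ) ^ 2 :=
    sub_pos.2 (sq_lt_sq' (abs_lt.1 hβ).1 (abs_lt.1 hβ).2)
  have hpos2 (t : ℝ) (ht : |t| < α - |α * ρ|) : 0 < α ^ 2 - (α * ρ + t) ^ 2 :=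
    sub_pos.2 (sq_lt_sq' (abs_lt.1 (hbound t ht)).1 (abs_lt.1 (hbound t ht)).2)
  have hmgf (t : ℝ) (ht : |t| < α - |α * ρ|) : mgf (fun ω => (∑ i, Z i ω) / (n : ℝ)) P t =
      ((α ^ 2 - (α * ρ) ^ 2) / (α ^ 2 - (α * ρ + t) ^ 2)) ^ (((n : ℝ) - 1) / 2 + 1 / 2) := by
    have hp := hpos2 t ht
    have h1 := lintegral_exp_mul_normal_product (t := (n : ℝ)⁻¹ * t) hσU hρ hUV hU0 hV0 hU hV hcov
      (by rw [← hquad]; positivity)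
    rw [← hquad, one_div_div] at h1
    have h2 (i) : mgf (Z i) P ((n : ℝ)⁻¹ * t) =
        ((α ^ 2 - (α * ρ) ^ 2) / (α ^ 2 - (α * ρ + t) ^ 2)) ^ (1 / 2 : ℝ) := by
      rw [mgf_congr_of_identDistrib _ _ (hident i)]
      exact mgf_of_lintegral_eq (hident i).aemeasurable_snd (by positivity) h1
    rw [hfun, mgf_const_mul, hindep.mgf_sum₀ hZ, Finset.prod_congr rfl fun i _ => h2 i,
      Finset.prod_const, Finset.card_univ, Fintype.card_fin, ← Real.rpow_natCast,
      ← Real.rpow_mul (by positivity)]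
    congr 1
    ring
  refine ⟨hbar, ?_⟩
  have := Measure.isProbabilityMeasure_map hbar
  refine ext_of_mgf_eqOn (r := α - |α * ρ|) (by linarith) (fun t ht => ?_) (fun t ht => ?_)
    fun t ht => ?_
  · -- a positive value of the moment generating function certifies integrability
    have h3 : 0 < mgf (fun ω => (∑ i, Z i ω) / (n : ℝ)) P t := by
      rw [hmgf t ht]
      have := hpos2 t ht
      positivity
    exact (integrable_map_measure (by fun_prop) hbar).2 (mgf_pos_iff.1 h3)
  · exact integrable_exp_of_lintegral_eq (X := fun x => x) aemeasurable_id
      (lintegral_exp_vgMeasure hν hβ (hbound t ht))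
  · rw [mgf_id_map hbar, hmgf t ht]
    have := hpos2 t ht
    exact (mgf_of_lintegral_eq (X := id) aemeasurable_id (by positivity)
      (lintegral_exp_vgMeasure hν hβ (hbound t ht))).symm

/-! ### Series for the variance-gamma distribution function -/

lemma integrable_vgPDF {ν α β : ℝ} (hν : -(1 / 2) < ν) (hβ : |β| < α) :
    Integrable (vgPDF ν α β 0) := by
  refine ⟨(measurable_vgPDF _ _ _ _).aestronglyMeasurable, ?_⟩
  rw [hasFiniteIntegral_iff_ofReal (ae_of_all _ (vgPDF_nonneg hν hβ 0)), lintegral_vgPDF hν hβ]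
  exact ENNReal.one_lt_top

lemma integral_vgPDF {ν α β : ℝ} (hν : -(1 / 2) < ν) (hβ : |β| < α) :
    ∫ x, vgPDF ν α β 0 x = 1 := by
  rw [integral_eq_lintegral_of_nonneg_ae (ae_of_all _ (vgPDF_nonneg hν hβ 0))
    (measurable_vgPDF _ _ _ _).aestronglyMeasurable, lintegral_vgPDF hν hβ, ENNReal.toReal_one]

lemma vgMeasure_real {ν α β : ℝ} (hν : -(1 / 2) < ν) (hβ : |β| < α) {s : Set ℝ}
    (hs : MeasurableSet s) : (vgMeasure ν α β 0).real s = ∫ x in s, vgPDF ν α β 0 x := by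
  rw [Measure.real, vgMeasure, withDensity_apply _ hs, integral_eq_lintegral_of_nonneg_ae
    (ae_of_all _ (vgPDF_nonneg hν hβ 0)) (measurable_vgPDF _ _ _ _).aestronglyMeasurable]

lemma vgPDF_neg (ν α β x : ℝ) : vgPDF ν α β 0 (-x) = vgPDF ν α (-β) 0 x := by
  simp [vgPDF]

open Set in
/-- Expanding `exp (β * y)` in the variance-gamma density and integrating term by term. -/
lemma hasSum_setIntegral_vgPDF {ν α β : ℝ} (hν : -(1 / 2) < ν) (hβ : |β| < α) {s : Set ℝ}
    (hs : MeasurableSet s) (hs0 : s ⊆ Ioi 0) :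
    HasSum (fun k : ℕ => (α ^ 2 - β ^ 2) ^ (ν + 1 / 2) /
        (Real.sqrt Real.pi * (2 * α) ^ ν * Real.Gamma (ν + 1 / 2)) * (β ^ k / k.factorial) *
        ∫ y in s, y ^ (ν + k) * besselK ν (α * y))
      (∫ y in s, vgPDF ν α β 0 y) := by
  have hα : 0 < α := (abs_nonneg β).trans_lt hβ
  obtain ⟨C, hC⟩ : ∃ C, C = (α ^ 2 - β ^ 2) ^ (ν + 1 / 2) /
    (Real.sqrt Real.pi * (2 * α) ^ ν * Real.Gamma (ν + 1 / 2)) := ⟨_, rfl⟩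
  have hC0 : 0 ≤ C := by
    have h1 : 0 < α ^ 2 - β ^ 2 := sub_pos.2 (sq_lt_sq' (abs_lt.1 hβ).1 (abs_lt.1 hβ).2)
    have h2 := Real.Gamma_pos_of_pos (show 0 < ν + 1 / 2 by linarith)
    rw [hC]; positivity
  have hsum (γ : ℝ) (hγ : |γ| = |β|) (y : ℝ) (hy : 0 < y) :
      HasSum (fun k : ℕ => C * (γ ^ k / k.factorial) * (y ^ (ν + k) * besselK ν (α * y)))
        (vgPDF ν α γ 0 y) := by
    have h := (NormedSpace.expSeries_div_hasSum_exp (𝔸 := ℝ) (γ * y)).mul_left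
      (C * (y ^ ν * besselK ν (α * y)))
    rw [← Real.exp_eq_exp_ℝ] at h
    have hv : vgPDF ν α γ 0 y = C * (y ^ ν * besselK ν (α * y)) * Real.exp (γ * y) := by
      rw [vgPDF, sub_zero, abs_of_pos hy, hC, ← sq_abs γ, hγ, sq_abs]
      ring
    rw [hv]
    refine HasSum.congr_fun h fun k => ?_
    rw [Real.rpow_add hy, Real.rpow_natCast, mul_pow]
    ring
  have hbm := measurable_besselK ν
  have hmeas (c : ℝ) (k : ℕ) : Measurable fun y : ℝ => c * (y ^ (ν + k) * besselK ν (α * y)) :=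
    ((by fun_prop : Measurable fun y : ℝ => y ^ (ν + k)).mul
      (hbm.comp (by fun_prop : Measurable fun y : ℝ => α * y))).const_mul c
  have key := hasSum_integral_of_dominated_convergence (μ := volume.restrict s)
    (F := fun (k : ℕ) y => C * (β ^ k / k.factorial) * (y ^ (ν + k) * besselK ν (α * y)))
    (f := vgPDF ν α β 0)
    -- the dominating series sums to the density with `|β|` for `β`
    (fun k y => C * (|β| ^ k / k.factorial) * (y ^ (ν + k) * besselK ν (α * y)))
    (fun k => (hmeas _ k).aestronglyMeasurable)
    (fun k => by
      filter_upwards [self_mem_ae_restrict hs] with y hy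
      have hy : 0 < y := hs0 hy
      have := besselK_nonneg ν (α * y)
      rw [norm_mul, norm_mul, norm_div, norm_pow, Real.norm_of_nonneg hC0, Real.norm_eq_abs β,
        Real.norm_of_nonneg (show (0 : ℝ) ≤ k.factorial by positivity),
        Real.norm_of_nonneg (by positivity)])
    (by
      filter_upwards [self_mem_ae_restrict hs] with y hy
      exact (hsum |β| (abs_abs β) y (hs0 hy)).summable)
    (by
      refine ((integrable_vgPDF (β := |β|) hν (by rwa [abs_abs])).restrict (s := s)).congr ?_
      filter_upwards [self_mem_ae_restrict hs] with y hy
      exact (hsum |β| (abs_abs β) y (hs0 hy)).tsum_eq.symm)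
    (by
      filter_upwards [self_mem_ae_restrict hs] with y hy
      exact hsum β rfl y (hs0 hy))
  simp only [integral_const_mul] at key
  rwa [hC] at key

/-- The constants of the variance-gamma density, the scaling `y ↦ α * y` and the Mellin transform
combine to the coefficient of the series for the distribution function. -/
lemma vg_coefficient {m α ρ : ℝ} (hα : 0 < α) (hρ : |ρ| < 1) (k : ℕ) :
    (α ^ 2 - (α * ρ) ^ 2) ^ ((m - 1) / 2 + 1 / 2) /
        (Real.sqrt Real.pi * (2 * α) ^ ((m - 1) / 2) * Real.Gamma ((m - 1) / 2 + 1 / 2)) *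
        ((α * ρ) ^ k / k.factorial) *
        (α ^ ((m - 1) / 2 + k + 1))⁻¹ * 2 ^ ((m - 1) / 2 + k - 1) =
      (1 - ρ ^ 2) ^ (m / 2) / (2 * Real.sqrt Real.pi * Real.Gamma (m / 2)) *
        ((2 * ρ) ^ k / k.factorial) := by
  have hρ2 : 0 < 1 - ρ ^ 2 := by
    have := sq_lt_one_iff_abs_lt_one ρ |>.2 hρ
    linarith
  rw [show (m - 1) / 2 + 1 / 2 = m / 2 by ring,
    show α ^ 2 - (α * ρ) ^ 2 = α ^ 2 * (1 - ρ ^ 2) by ring,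
    Real.mul_rpow (by positivity) hρ2.le, ← Real.rpow_natCast α 2, ← Real.rpow_mul hα.le,
    show ((2 : ℕ) : ℝ) * (m / 2) = (m - 1) / 2 + (m - 1) / 2 + 1 by push_cast; ring,
    Real.mul_rpow zero_le_two hα.le, Real.rpow_add_one hα.ne', Real.rpow_add_one hα.ne',
    Real.rpow_add hα, Real.rpow_add_natCast hα.ne', Real.rpow_sub_one two_ne_zero,
    Real.rpow_add_natCast two_ne_zero, mul_pow, mul_pow]
  have h1 : 0 < α ^ ((m - 1) / 2) := by positivity
  have h2 : (0 : ℝ) < 2 ^ ((m - 1) / 2) := by positivity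
  generalize Real.Gamma (m / 2) = g
  generalize (1 - ρ ^ 2) ^ (m / 2) = W
  generalize α ^ ((m - 1) / 2) = X at *
  generalize (2 : ℝ) ^ ((m - 1) / 2) = Y at *
  field_simp

open Set in
lemma integral_Ioi_rpow_mul_besselK_mul {m α x : ℝ} (hm : 0 < m) (hα : 0 < α) (hx : 0 ≤ x)
    (k : ℕ) :
    ∫ y in Ioi x, y ^ ((m - 1) / 2 + k) * besselK ((m - 1) / 2) (α * y) =
      (α ^ ((m - 1) / 2 + k + 1))⁻¹ * 2 ^ ((m - 1) / 2 + k - 1) *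
        (Real.Gamma (((k : ℝ) + 1) / 2) * Real.Gamma ((m + k) / 2) *
          lommelGTilde ((m - 1) / 2 + k) ((m - 1) / 2) (α * x)) := by
  have hk : (0 : ℝ) ≤ k := k.cast_nonneg
  have h := integral_comp_mul_left_Ioi
    (fun u => u ^ ((m - 1) / 2 + k) * besselK ((m - 1) / 2) u) x hα
  rw [integral_Ioi_rpow_mul_besselK (by linarith) (by linarith) (by positivity)] at h
  have h2 : ∫ y in Ioi x, y ^ ((m - 1) / 2 + k) * besselK ((m - 1) / 2) (α * y) =
      (α ^ ((m - 1) / 2 + k))⁻¹ *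
        ∫ y in Ioi x, (α * y) ^ ((m - 1) / 2 + k) * besselK ((m - 1) / 2) (α * y) := by
    rw [← integral_const_mul]
    refine setIntegral_congr_fun measurableSet_Ioi fun y hy => ?_
    have hy : 0 < y := hx.trans_lt hy
    have : 0 < α ^ ((m - 1) / 2 + k) := by positivity
    rw [Real.mul_rpow hα.le hy.le]
    field_simp
  rw [h2, h, Real.rpow_add_one hα.ne', smul_eq_mul,
    show ((m - 1) / 2 + k - (m - 1) / 2 + 1) / 2 = ((k : ℝ) + 1) / 2 by ring,
    show ((m - 1) / 2 + k + (m - 1) / 2 + 1) / 2 = (m + k) / 2 by ring, mul_inv]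
  ring

open Set in
lemma integral_Ioc_rpow_mul_besselK_mul {m α x : ℝ} (hm : 0 < m) (hα : 0 < α) (hx : 0 ≤ x)
    (k : ℕ) :
    ∫ y in Ioc 0 x, y ^ ((m - 1) / 2 + k) * besselK ((m - 1) / 2) (α * y) =
      (α ^ ((m - 1) / 2 + k + 1))⁻¹ * 2 ^ ((m - 1) / 2 + k - 1) *
        (Real.Gamma (((k : ℝ) + 1) / 2) * Real.Gamma ((m + k) / 2) *
          lommelG ((m - 1) / 2 + k) ((m - 1) / 2) (α * x)) := by
  have hk : (0 : ℝ) ≤ k := k.cast_nonneg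
  have h := intervalIntegral.integral_comp_mul_left (a := 0) (b := x)
    (fun u => u ^ ((m - 1) / 2 + k) * besselK ((m - 1) / 2) u) hα.ne'
  rw [mul_zero, intervalIntegral.integral_of_le hx, intervalIntegral.integral_of_le (by positivity),
    integral_Ioc_rpow_mul_besselK (by linarith) (by linarith) (by positivity)] at h
  have h2 : ∫ y in Ioc 0 x, y ^ ((m - 1) / 2 + k) * besselK ((m - 1) / 2) (α * y) =
      (α ^ ((m - 1) / 2 + k))⁻¹ *
        ∫ y in Ioc 0 x, (α * y) ^ ((m - 1) / 2 + k) * besselK ((m - 1) / 2) (α * y) := by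
    rw [← integral_const_mul]
    refine setIntegral_congr_fun measurableSet_Ioc fun y hy => ?_
    have hy : 0 < y := hy.1
    have : 0 < α ^ ((m - 1) / 2 + k) := by positivity
    rw [Real.mul_rpow hα.le hy.le]
    field_simp
  rw [h2, h, Real.rpow_add_one hα.ne', smul_eq_mul,
    show ((m - 1) / 2 + k - (m - 1) / 2 + 1) / 2 = ((k : ℝ) + 1) / 2 by ring,
    show ((m - 1) / 2 + k + (m - 1) / 2 + 1) / 2 = (m + k) / 2 by ring, mul_inv]
  ring

lemma vg_const_pos {m ρ : ℝ} (hm : 0 < m) (hρ : |ρ| < 1) :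
    0 < (1 - ρ ^ 2) ^ (m / 2) / (2 * Real.sqrt Real.pi * Real.Gamma (m / 2)) := by
  have := sq_lt_one_iff_abs_lt_one ρ |>.2 hρ
  have h1 : 0 < 1 - ρ ^ 2 := by linarith
  have h2 := Real.Gamma_pos_of_pos (half_pos hm)
  positivity

lemma abs_mul_lt_self {α ρ : ℝ} (hα : 0 < α) (hρ : |ρ| < 1) : |α * ρ| < α := by
  rw [abs_mul, abs_of_pos hα]
  exact mul_lt_of_lt_one_right hα hρ

open Set in
lemma exists_hasSum_integral_Ioi_vgPDF {m α ρ x : ℝ} (hm : 0 < m) (hα : 0 < α) (hρ : |ρ| < 1)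
    (hx : 0 ≤ x) :
    ∃ S, HasSum (fun k : ℕ => (2 * ρ) ^ k / (Nat.factorial k : ℝ) *
          Real.Gamma (((k : ℝ) + 1) / 2) * Real.Gamma ((m + k) / 2) *
          lommelGTilde ((m - 1) / 2 + k) ((m - 1) / 2) (α * x)) S ∧
      ∫ y in Ioi x, vgPDF ((m - 1) / 2) α (α * ρ) 0 y =
        (1 - ρ ^ 2) ^ (m / 2) / (2 * Real.sqrt Real.pi * Real.Gamma (m / 2)) * S := by
  have hA := vg_const_pos hm hρ
  have h := hasSum_setIntegral_vgPDF (ν := (m - 1) / 2) (by linarith) (abs_mul_lt_self hα hρ)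
    (measurableSet_Ioi (a := x)) (Ioi_subset_Ioi hx)
  refine ⟨_, ?_, (mul_inv_cancel_left₀ hA.ne' _).symm⟩
  refine HasSum.congr_fun
    (h.mul_left ((1 - ρ ^ 2) ^ (m / 2) / (2 * Real.sqrt Real.pi * Real.Gamma (m / 2)))⁻¹)
    fun k => ?_
  rw [integral_Ioi_rpow_mul_besselK_mul hm hα hx, eq_inv_mul_iff_mul_eq₀ hA.ne']
  linear_combination (-(Real.Gamma (((k : ℝ) + 1) / 2) * Real.Gamma ((m + k) / 2) *
    lommelGTilde ((m - 1) / 2 + k) ((m - 1) / 2) (α * x))) * vg_coefficient (m := m) hα hρ k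

open Set in
lemma exists_hasSum_integral_Ioc_vgPDF {m α ρ x : ℝ} (hm : 0 < m) (hα : 0 < α) (hρ : |ρ| < 1)
    (hx : 0 ≤ x) :
    ∃ S, HasSum (fun k : ℕ => (2 * ρ) ^ k / (Nat.factorial k : ℝ) *
          Real.Gamma (((k : ℝ) + 1) / 2) * Real.Gamma ((m + k) / 2) *
          lommelG ((m - 1) / 2 + k) ((m - 1) / 2) (α * x)) S ∧
      ∫ y in Ioc 0 x, vgPDF ((m - 1) / 2) α (α * ρ) 0 y =
        (1 - ρ ^ 2) ^ (m / 2) / (2 * Real.sqrt Real.pi * Real.Gamma (m / 2)) * S := by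
  have hA := vg_const_pos hm hρ
  have h := hasSum_setIntegral_vgPDF (ν := (m - 1) / 2) (by linarith) (abs_mul_lt_self hα hρ)
    (measurableSet_Ioc (a := 0) (b := x)) Ioc_subset_Ioi_self
  refine ⟨_, ?_, (mul_inv_cancel_left₀ hA.ne' _).symm⟩
  refine HasSum.congr_fun
    (h.mul_left ((1 - ρ ^ 2) ^ (m / 2) / (2 * Real.sqrt Real.pi * Real.Gamma (m / 2)))⁻¹)
    fun k => ?_
  rw [integral_Ioc_rpow_mul_besselK_mul hm hα hx, eq_inv_mul_iff_mul_eq₀ hA.ne']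
  linear_combination (-(Real.Gamma (((k : ℝ) + 1) / 2) * Real.Gamma ((m + k) / 2) *
    lommelG ((m - 1) / 2 + k) ((m - 1) / 2) (α * x))) * vg_coefficient (m := m) hα hρ k

open Set in
lemma integral_Iic_vgPDF_eq_one_sub {ν α β : ℝ} (hν : -(1 / 2) < ν) (hβ : |β| < α) (x : ℝ) :
    ∫ y in Iic x, vgPDF ν α β 0 y = 1 - ∫ y in Ioi x, vgPDF ν α β 0 y := by
  have h := integral_add_compl (measurableSet_Iic (a := x)) (integrable_vgPDF hν hβ)
  rw [integral_vgPDF hν hβ, compl_Iic] at h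
  linarith

open Set in
lemma integral_Iic_vgPDF_eq_neg (ν α β x : ℝ) :
    ∫ y in Iic x, vgPDF ν α β 0 y = ∫ y in Ioi (-x), vgPDF ν α (-β) 0 y := by
  have h := integral_comp_neg_Ioi (-x) (vgPDF ν α β 0)
  rw [neg_neg] at h
  rw [← h]
  simp only [vgPDF_neg]

lemma Gamma_add_natCast {b : ℝ} (hb : 0 < b) (j : ℕ) :
    Real.Gamma (b + j) = Real.Gamma b * (ascPochhammer ℝ j).eval b := by
  induction j with
  | zero => simp
  | succ j ih =>
    rw [ascPochhammer_succ_eval, Nat.cast_succ, ← add_assoc, Real.Gamma_add_one (by positivity), ih]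
    ring

/-- `(2 * j + 1)! = 4 ^ j * j! * (3 / 2)_j`, with the rising factorial `(3 / 2)_j`. -/
lemma factorial_two_mul_add_one (j : ℕ) :
    ((2 * j + 1).factorial : ℝ) = 4 ^ j * j.factorial * (ascPochhammer ℝ j).eval (3 / 2) := by
  induction j with
  | zero => simp
  | succ j ih =>
    rw [show 2 * (j + 1) + 1 = (2 * j + 1) + 1 + 1 by ring, Nat.factorial_succ, Nat.factorial_succ,
      Nat.cast_mul, Nat.cast_mul, ih, ascPochhammer_succ_eval, Nat.factorial_succ]
    push_cast
    ring

lemma lommelGTilde_zero (μ ν : ℝ) : lommelGTilde μ ν 0 = 1 := by simp [lommelGTilde]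

open Set in
/-- The mass on the negative half-line: it and its reflection sum to one, while the odd part of
the series for the tail at zero is hypergeometric. -/
lemma integral_Iic_zero_vgPDF {m α ρ : ℝ} (hm : 0 < m) (hα : 0 < α) (hρ : |ρ| < 1) :
    ∫ y in Iic 0, vgPDF ((m - 1) / 2) α (α * ρ) 0 y =
      1 / 2 - Real.Gamma ((m + 1) / 2) / (Real.sqrt Real.pi * Real.Gamma (m / 2)) *
          ρ * (1 - ρ ^ 2) ^ (m / 2) *
          ordinaryHypergeometric (1 : ℝ) ((m + 1) / 2) (3 / 2) (ρ ^ 2) := by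
  obtain ⟨S, hS, hS'⟩ := exists_hasSum_integral_Ioi_vgPDF hm hα hρ le_rfl
  obtain ⟨T, hT, hT'⟩ := exists_hasSum_integral_Ioi_vgPDF hm hα
    (show |-ρ| < 1 by rwa [abs_neg]) le_rfl
  have e1 := integral_Iic_vgPDF_eq_one_sub (ν := (m - 1) / 2) (by linarith)
    (abs_mul_lt_self hα hρ) 0
  have e2 := integral_Iic_vgPDF_eq_neg ((m - 1) / 2) α (α * ρ) 0
  rw [neg_zero, ← mul_neg, hT', neg_sq] at e2
  rw [hS'] at e1
  -- the even terms cancel in the difference of the series for `ρ` and `-ρ`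
  have hodd := hS.sub hT
  have hinj : Function.Injective fun j : ℕ => 2 * j + 1 := fun a b h => by
    simpa using h
  rw [← hinj.hasSum_iff] at hodd
  · have hval : HasSum (fun j : ℕ => 4 * ρ * Real.Gamma ((m + 1) / 2) *
        (((j.factorial : ℝ)⁻¹ * (ascPochhammer ℝ j).eval 1 *
          (ascPochhammer ℝ j).eval ((m + 1) / 2) * ((ascPochhammer ℝ j).eval (3 / 2))⁻¹) •
            (ρ ^ 2) ^ j)) (S - T) := by
      refine HasSum.congr_fun hodd fun j => ?_
      have h1 : (((2 * j + 1 : ℕ) : ℝ) + 1) / 2 = (j : ℝ) + 1 := by push_cast; ring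
      have h2 : (m + ((2 * j + 1 : ℕ) : ℝ)) / 2 = (m + 1) / 2 + j := by push_cast; ring
      have h3 : (0 : ℝ) < (ascPochhammer ℝ j).eval (3 / 2) := ascPochhammer_pos _ _ (by norm_num)
      have h4 : (2 * -ρ) ^ (2 * j + 1) = -(2 * ρ) ^ (2 * j + 1) := by
        rw [mul_neg, Odd.neg_pow ⟨j, rfl⟩]
      have h5 : (2 * ρ) ^ (2 * j + 1) = 2 * ρ * (4 ^ j * (ρ ^ 2) ^ j) := by
        rw [pow_succ, pow_mul, mul_pow, mul_pow]; norm_num; ring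
      simp only [Function.comp, mul_zero, lommelGTilde_zero]
      rw [h1, h2, h4, h5, factorial_two_mul_add_one, Gamma_add_natCast (by positivity),
        Real.Gamma_nat_eq_factorial, ascPochhammer_eval_one, smul_eq_mul]
      field_simp
      ring
    have hF := hval.tsum_eq
    rw [tsum_mul_left] at hF
    rw [ordinaryHypergeometric_eq_tsum]
    beta_reduce
    have hg := Real.Gamma_pos_of_pos (half_pos hm)
    generalize (∑' j : ℕ, (((j.factorial : ℝ)⁻¹ * (ascPochhammer ℝ j).eval 1 *
          (ascPochhammer ℝ j).eval ((m + 1) / 2) * ((ascPochhammer ℝ j).eval (3 / 2))⁻¹) •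
            (ρ ^ 2) ^ j)) = F at *
    have hkey : (1 - ρ ^ 2) ^ (m / 2) / (2 * Real.sqrt Real.pi * Real.Gamma (m / 2)) * (S - T) =
        2 * (Real.Gamma ((m + 1) / 2) / (Real.sqrt Real.pi * Real.Gamma (m / 2)) *
          ρ * (1 - ρ ^ 2) ^ (m / 2) * F) := by
      rw [← hF]
      generalize (1 - ρ ^ 2) ^ (m / 2) = W
      field_simp
      norm_num
    linarith
  · intro k hk
    have hk' : Even k := by
      by_contra h
      obtain ⟨j, rfl⟩ := Nat.not_even_iff_odd.1 h
      exact hk ⟨j, rfl⟩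
    rw [mul_neg, hk'.neg_pow, sub_self]

open Set in
lemma exists_hasSum_integral_Iic_vgPDF {m α ρ : ℝ} (hm : 0 < m) (hα : 0 < α) (hρ : |ρ| < 1)
    (x : ℝ) :
    ∃ S, HasSum (fun k : ℕ => Real.sign x ^ (k + 1) * ((2 * ρ) ^ k / (Nat.factorial k : ℝ)) *
          Real.Gamma (((k : ℝ) + 1) / 2) * Real.Gamma ((m + k) / 2) *
          lommelG ((m - 1) / 2 + k) ((m - 1) / 2) (α * |x|)) S ∧
      ∫ y in Iic x, vgPDF ((m - 1) / 2) α (α * ρ) 0 y =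
        (∫ y in Iic 0, vgPDF ((m - 1) / 2) α (α * ρ) 0 y) +
        (1 - ρ ^ 2) ^ (m / 2) / (2 * Real.sqrt Real.pi * Real.Gamma (m / 2)) * S := by
  rcases lt_trichotomy x 0 with hx | rfl | hx
  · obtain ⟨S, hS, hS'⟩ := exists_hasSum_integral_Ioc_vgPDF (x := -x) hm hα
      (show |-ρ| < 1 by rwa [abs_neg]) (by linarith)
    refine ⟨-S, ?_, ?_⟩
    · rw [Real.sign_of_neg hx, abs_of_neg hx]
      refine HasSum.congr_fun hS.neg fun k => ?_
      have e : (2 * -ρ) ^ k = (-1) ^ k * (2 * ρ) ^ k := by rw [← mul_pow]; congr 1; ring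
      rw [e]
      ring
    · have hint := integrable_vgPDF (ν := (m - 1) / 2) (by linarith)
        (abs_mul_lt_self hα (show |-ρ| < 1 by rwa [abs_neg]))
      have h := setIntegral_union (Ioc_disjoint_Ioi (a := 0) (le_refl (-x))) measurableSet_Ioi
        hint.integrableOn hint.integrableOn
      rw [Ioc_union_Ioi_eq_Ioi (by linarith), hS', neg_sq] at h
      rw [integral_Iic_vgPDF_eq_neg, integral_Iic_vgPDF_eq_neg, neg_zero, ← mul_neg, h]
      ring
  · exact ⟨0, by simp, by simp⟩
  · obtain ⟨S, hS, hS'⟩ := exists_hasSum_integral_Ioc_vgPDF hm hα hρ hx.le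
    refine ⟨S, ?_, ?_⟩
    · rw [Real.sign_of_pos hx, abs_of_pos hx]
      simpa only [one_pow, one_mul] using hS
    · have hint := integrable_vgPDF (ν := (m - 1) / 2) (by linarith) (abs_mul_lt_self hα hρ)
      have h := setIntegral_union (Iic_disjoint_Ioc (c := x) (le_refl 0)) measurableSet_Ioc
        hint.integrableOn hint.integrableOn
      rw [Iic_union_Ioc_eq_Iic hx.le, hS'] at h
      exact h

/-! ### Distribution of the mean of independent normal products -/

theorem mainTheorem2
    {Ω₀ : Type*} [MeasurableSpace Ω₀] (P₀ : Measure Ω₀) [IsProbabilityMeasure P₀]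
    {Ω : Type*} [MeasurableSpace Ω] (P : Measure Ω) [IsProbabilityMeasure P]
    (σU σV ρ s : ℝ) (hσU : 0 < σU) (hσV : 0 < σV) (hρ : |ρ| < 1) (hs : s = σU * σV)
    (U V : Ω₀ → ℝ)
    (hUV : HasGaussianLaw (fun ω => (U ω, V ω)) P₀)
    (hU0 : ∫ ω, U ω ∂P₀ = 0) (hV0 : ∫ ω, V ω ∂P₀ = 0)
    (hU : variance U P₀ = σU ^ 2) (hV : variance V P₀ = σV ^ 2)
    (hcov : covariance U V P₀ = ρ * σU * σV)
    (n : ℕ) (hn : 1 ≤ n)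
    (Z : Fin n → Ω → ℝ)
    (hindep : iIndepFun Z P)
    (hident : ∀ i, IdentDistrib (Z i) (fun ω => U ω * V ω) P P₀)
    (Zbar : Ω → ℝ) (hZbar : ∀ ω, Zbar ω = (∑ i, Z i ω) / (n : ℝ)) :
    HasLaw Zbar
      (vgMeasure (((n : ℝ) - 1) / 2) ((n : ℝ) / (s * (1 - ρ ^ 2)))
        ((n : ℝ) * ρ / (s * (1 - ρ ^ 2))) 0) P ∧
    (∀ x : ℝ, 0 ≤ x →
      ∃ S : ℝ,
        HasSum (fun k : ℕ => (2 * ρ) ^ k / (Nat.factorial k : ℝ) *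
          Real.Gamma (((k : ℝ) + 1) / 2) * Real.Gamma (((n : ℝ) + (k : ℝ)) / 2) *
          lommelGTilde (((n : ℝ) - 1) / 2 + (k : ℝ)) (((n : ℝ) - 1) / 2)
            ((n : ℝ) * x / (s * (1 - ρ ^ 2)))) S ∧
        P.real {ω | Zbar ω ≤ x} =
          1 - (1 - ρ ^ 2) ^ ((n : ℝ) / 2) /
            (2 * Real.sqrt Real.pi * Real.Gamma ((n : ℝ) / 2)) * S) ∧
    (∀ x : ℝ, x < 0 →
      ∃ S : ℝ,
        HasSum (fun k : ℕ => (-2 * ρ) ^ k / (Nat.factorial k : ℝ) *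
          Real.Gamma (((k : ℝ) + 1) / 2) * Real.Gamma (((n : ℝ) + (k : ℝ)) / 2) *
          lommelGTilde (((n : ℝ) - 1) / 2 + (k : ℝ)) (((n : ℝ) - 1) / 2)
            (-((n : ℝ) * x / (s * (1 - ρ ^ 2))))) S ∧
        P.real {ω | Zbar ω ≤ x} =
          (1 - ρ ^ 2) ^ ((n : ℝ) / 2) /
            (2 * Real.sqrt Real.pi * Real.Gamma ((n : ℝ) / 2)) * S) ∧
    (∀ x : ℝ,
      ∃ S : ℝ,
        HasSum (fun k : ℕ => Real.sign x ^ (k + 1) * ((2 * ρ) ^ k / (Nat.factorial k : ℝ)) *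
          Real.Gamma (((k : ℝ) + 1) / 2) * Real.Gamma (((n : ℝ) + (k : ℝ)) / 2) *
          lommelG (((n : ℝ) - 1) / 2 + (k : ℝ)) (((n : ℝ) - 1) / 2)
            ((n : ℝ) * |x| / (s * (1 - ρ ^ 2)))) S ∧
        P.real {ω | Zbar ω ≤ x} =
          1 / 2 - Real.Gamma (((n : ℝ) + 1) / 2) /
              (Real.sqrt Real.pi * Real.Gamma ((n : ℝ) / 2)) *
              ρ * (1 - ρ ^ 2) ^ ((n : ℝ) / 2) *
              ordinaryHypergeometric (1 : ℝ) (((n : ℝ) + 1) / 2) (3 / 2) (ρ ^ 2) +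
            (1 - ρ ^ 2) ^ ((n : ℝ) / 2) /
              (2 * Real.sqrt Real.pi * Real.Gamma ((n : ℝ) / 2)) * S) ∧
    P.real {ω | Zbar ω ≤ 0} =
      1 / 2 - Real.Gamma (((n : ℝ) + 1) / 2) /
          (Real.sqrt Real.pi * Real.Gamma ((n : ℝ) / 2)) *
          ρ * (1 - ρ ^ 2) ^ ((n : ℝ) / 2) *
          ordinaryHypergeometric (1 : ℝ) (((n : ℝ) + 1) / 2) (3 / 2) (ρ ^ 2) := by
  subst hs
  have hn0 : (0 : ℝ) < n := by exact_mod_cast hn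
  have hρ2 : 0 < 1 - ρ ^ 2 := by
    have := sq_lt_one_iff_abs_lt_one ρ |>.2 hρ
    linarith
  obtain ⟨α, hα⟩ : ∃ α, α = (n : ℝ) / (σU * σV * (1 - ρ ^ 2)) := ⟨_, rfl⟩
  have hα0 : 0 < α := by rw [hα]; positivity
  have harg (x : ℝ) : (n : ℝ) * x / (σU * σV * (1 - ρ ^ 2)) = α * x := by rw [hα]; ring
  have hν : -(1 / 2) < ((n : ℝ) - 1) / 2 := by linarith
  have hlaw : HasLaw Zbar (vgMeasure (((n : ℝ) - 1) / 2) α (α * ρ) 0) P := by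
    rw [funext hZbar, hα]
    exact hasLaw_mean_normal_product hσU hσV hρ hUV hU0 hV0 hU hV hcov hn hindep hident
  have hcdf (x : ℝ) : P.real {ω | Zbar ω ≤ x} =
      ∫ y in Set.Iic x, vgPDF (((n : ℝ) - 1) / 2) α (α * ρ) 0 y := by
    rw [hlaw.measureReal_eq (p := fun y => y ≤ x) measurableSet_Iic, ← vgMeasure_real hν
      (abs_mul_lt_self hα0 hρ) measurableSet_Iic]
    rfl
  simp only [harg, hcdf, ← hα]
  refine ⟨hlaw, fun x hx => ?_, fun x hx => ?_, fun x => ?_, integral_Iic_zero_vgPDF hn0 hα0 hρ⟩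
  · obtain ⟨S, hS, hS'⟩ := exists_hasSum_integral_Ioi_vgPDF hn0 hα0 hρ hx
    exact ⟨S, hS, by rw [integral_Iic_vgPDF_eq_one_sub hν (abs_mul_lt_self hα0 hρ), hS']⟩
  · obtain ⟨S, hS, hS'⟩ := exists_hasSum_integral_Ioi_vgPDF (x := -x) hn0 hα0
      (show |-ρ| < 1 by rwa [abs_neg]) (by linarith)
    refine ⟨S, ?_, by rw [integral_Iic_vgPDF_eq_neg, ← mul_neg, hS', neg_sq]⟩
    simpa only [mul_neg, neg_mul] using hS
  · obtain ⟨S, hS, hS'⟩ := exists_hasSum_integral_Iic_vgPDF hn0 hα0 hρ x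
    exact ⟨S, hS, by rw [hS', integral_Iic_zero_vgPDF hn0 hα0 hρ]⟩
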